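/- **Jibladze's theorem on fibred toposes.** Let $\mathbf B$ be a category with finite limits and let $P:\mathbf X\to\mathbf B$ be a topos fibred over $\mathbf B$, i.e. a fibration such that every fibre $P(I)=\mathbf X_I$ is an elementary topos (finite limits, exponentials, subobject classifier) and every reindexing functor $u^*:P(I)\to P(J)$, for $u:J\to I$ in $\mathbf B$, is logical (preserves finite limits, exponentials and the subobject classifier). Suppose that $P$ has internal sums: for every $X\in P(I)$ and $u:I\to J$ there is a cocartesian arrow $X\to Y$ over $u$, and the Beck–Chevalley condition holds, i.e. for every commuting square $\psi\circ\widetilde\varphi=\varphi\circ\widetilde\psi$ in $\mathbf X$ over a pullback square in $\mathbf B$, with $\psi,\widetilde\psi$ cartesian and $\varphi$ cocartesian, the arrow $\widetilde\varphi$ is cocartesian. Then $\mathbf X$ has pullbacks, and: 1. The internal sums of $P$ are universal: cocartesian arrows are stable under pullback along arbitrary arrows of $\mathbf X$. 2. The internal sums of $P$ are disjoint: for every cocartesian arrow $\varphi:X\to Y$ the diagonal $\delta_\varphi:X\to X\times_Y X$ (formed in $\mathbf X$) is cocartesian. 3. Let $\mathbf X_1$ be the fibre over the terminal object of $\mathbf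 B$, and let $\Delta:\mathbf B\to\mathbf X_1$ be the functor $I\mapsto\coprod_I 1_I$, where $1_I$ is terminal in $P(I)$ and $\varphi_I:1_I\to\coprod_I 1_I$ is cocartesian over $I\to 1$; for $u:J\to I$, $\Delta(u)$ is the unique vertical arrow with $\Delta(u)\circ\varphi_J=\varphi_I\circ 1_u$, where $1_u:1_J\to 1_I$ is the unique arrow over $u$. Then $\Delta$ preserves finite limits, and $P$ is equivalent, as a fibration over $\mathbf B$, to the glueing fibration $\mathsf{gl}(\Delta)=\partial_1:\mathbf X_1{\downarrow}\Delta\to\mathbf B$, whose objects over $I$ are the arrows $A\to\Delta(I)$ of $\mathbf X_1$. -/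

import Mathlib

open CategoryTheory CategoryTheory.Limits

universe v u v₁ u₁ v₂ u₂ v₃ u₃

namespace FibTopos

/-! ### Toposes and logical functors -/

section Topos

variable {C : Type u} [Category.{v} C]

/-- `ev : A × E ⟶ Y` exhibits `E` as the exponential `Y ^ A`: every `g : A × Z ⟶ Y` factors
through `ev` by a unique `h : Z ⟶ E`. -/
def IsExponential [HasFiniteLimits C] {A E Y : C} (ev : A ⨯ E ⟶ Y) : Prop :=
  ∀ (Z : C) (g : A ⨯ Z ⟶ Y), ∃! h : Z ⟶ E, prod.map (𝟙 A) h ≫ ev = g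

variable (C) in
/-- An (elementary) topos: a category with finite limits, exponentials and a subobject
classifier. -/
class IsTopos : Prop extends HasFiniteLimits C, HasSubobjectClassifier C where
  exists_exponential : ∀ A Y : C, ∃ (E : C) (ev : A ⨯ E ⟶ Y), IsExponential ev

/-- A functor between toposes is logical if it preserves finite limits, exponentials and the
subobject classifier. The map `ev'` below is the evaluation `F ev`, seen as a map out of
`F A × F E ≅ F (A × E)`. -/
class IsLogical {D : Type u₁} [Category.{v₁} D] [IsTopos C] [IsTopos D] (F : C ⥤ D) : Prop
    extends PreservesFiniteLimits F where
  exponential : ∀ {A E Y : C} (ev : A ⨯ E ⟶ Y), IsExponential ev →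
    ∀ ev' : F.obj A ⨯ F.obj E ⟶ F.obj Y, prodComparison F A E ≫ ev' = F.map ev →
      IsExponential ev'
  classifier : ∀ c : Subobject.Classifier C, ∃ c' : Subobject.Classifier D,
    Nonempty (Arrow.mk c'.truth ≅ Arrow.mk (F.map c.truth))

end Topos

section Fibrations

variable {B : Type u₁} [Category.{v₁} B] {X : Type u₂} [Category.{v₂} X]

/-! ### Cartesian and cocartesian arrows, reindexing -/

/-- `φ` is cartesian with respect to `P`, over its image `P.map φ`. -/
abbrev IsCart (P : X ⥤ B) {a b : X} (φ : a ⟶ b) : Prop :=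
  P.IsStronglyCartesian (P.map φ) φ

/-- `φ` is cocartesian with respect to `P`, over its image `P.map φ`. -/
abbrev IsCocart (P : X ⥤ B) {a b : X} (φ : a ⟶ b) : Prop :=
  P.IsStronglyCocartesian (P.map φ) φ

open Functor.IsPreFibered in
/-- The reindexing functor `u^* : P(I) ⥤ P(J)` along `u : J ⟶ I`, for a choice of cartesian
liftings. (Different choices give isomorphic functors.) -/
noncomputable def reindex (P : X ⥤ B) [P.IsFibered] {J I : B} (u : J ⟶ I) :
    P.Fiber I ⥤ P.Fiber J where
  obj a := ⟨pullbackObj a.2 u, pullbackObj_proj a.2 u⟩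
  map {a b} α :=
    haveI := α.2
    ⟨Functor.IsCartesian.map P u (pullbackMap b.2 u) (pullbackMap a.2 u ≫ α.1), inferInstance⟩
  map_id a := by
    apply Subtype.ext
    have : P.IsHomLift (𝟙 J) (𝟙 (pullbackObj a.2 u)) := IsHomLift.id (pullbackObj_proj a.2 u)
    have : P.IsHomLift (𝟙 I) (𝟙 a : a ⟶ a).1 := (𝟙 a : a ⟶ a).2
    refine (Functor.IsCartesian.map_uniq P u (pullbackMap a.2 u)
      (pullbackMap a.2 u ≫ (𝟙 a : a ⟶ a).1) (𝟙 (pullbackObj a.2 u)) ?_).symm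
    change 𝟙 _ ≫ _ = _ ≫ 𝟙 a.1
    simp
  map_comp {a b c} α β := by
    apply Subtype.ext
    have := α.2
    have := β.2
    symm
    have : P.IsHomLift (𝟙 I) (α.1 ≫ β.1) := inferInstance
    refine Functor.IsCartesian.map_uniq P u (pullbackMap c.2 u)
      (pullbackMap a.2 u ≫ α.1 ≫ β.1)
      (Functor.IsCartesian.map P u (pullbackMap b.2 u) (pullbackMap a.2 u ≫ α.1) ≫
        Functor.IsCartesian.map P u (pullbackMap c.2 u) (pullbackMap b.2 u ≫ β.1)) ?_
    simp

/-- A topos fibred over `B`: a fibration all of whose fibres are toposes and all of whose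
reindexing functors are logical. -/
class IsFibredTopos (P : X ⥤ B) : Prop extends P.IsFibered where
  topos : ∀ I : B, IsTopos (P.Fiber I)
  logical : ∀ {J I : B} (u : J ⟶ I), IsLogical (reindex P u)

attribute [instance] IsFibredTopos.topos IsFibredTopos.logical

/-! ### Internal sums -/

/-- `P` has internal sums: cocartesian liftings exist, and they satisfy the Beck-Chevalley
condition. -/
class HasInternalSums (P : X ⥤ B) : Prop where
  exists_cocartesian : ∀ (a : X) {J : B} (u : P.obj a ⟶ J),
    ∃ (b : X) (φ : a ⟶ b), P.IsStronglyCocartesian u φ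
  beckChevalley : ∀ {a b c d : X} (φ' : c ⟶ d) (ψ' : c ⟶ a) (ψ : d ⟶ b) (φ : a ⟶ b),
    φ' ≫ ψ = ψ' ≫ φ → IsPullback (P.map φ') (P.map ψ') (P.map ψ) (P.map φ) →
    IsCart P ψ → IsCart P ψ' → IsCocart P φ → IsCocart P φ'

/-- Internal sums are universal (stable): cocartesian arrows are stable under pullback along
arbitrary arrows of the total category. -/
def SumsUniversal (P : X ⥤ B) : Prop :=
  ∀ {a b c d : X} (φ' : c ⟶ d) (ψ' : c ⟶ a) (ψ : d ⟶ b) (φ : a ⟶ b),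
    IsPullback φ' ψ' ψ φ → IsCocart P φ → IsCocart P φ'

/-- Internal sums are disjoint: for every cocartesian arrow `φ`, the diagonal into the kernel pair
of `φ` is cocartesian. -/
def SumsDisjoint (P : X ⥤ B) : Prop :=
  ∀ {a b k : X} (φ : a ⟶ b) (π₁ π₂ : k ⟶ a) (δ : a ⟶ k),
    IsCocart P φ → IsPullback π₁ π₂ φ φ → δ ≫ π₁ = 𝟙 a → δ ≫ π₂ = 𝟙 a → IsCocart P δ

/-! ### The functor `Δ` -/

section Delta

variable (P : X ⥤ B)

/-- The terminal object `1_I` of the fibre over `I`, as an object of the total category. -/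
noncomputable def one [IsFibredTopos P] (I : B) : X := (⊤_ (P.Fiber I)).1

lemma one_proj [IsFibredTopos P] (I : B) : P.obj (one P I) = I := (⊤_ (P.Fiber I)).2

open Functor.IsPreFibered in
/-- There is exactly one arrow over `u : J ⟶ I` from an object over `J` to `1_I`. -/
lemma existsUnique_toOne [IsFibredTopos P] {J I : B} (u : J ⟶ I) (a : X) (ha : P.obj a = J) :
    ∃! f : a ⟶ one P I, P.IsHomLift u f := by
  have t : IsTerminal ((reindex P u).obj (⊤_ (P.Fiber I))) :=
    IsTerminal.isTerminalObj (reindex P u) _ terminalIsTerminal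
  let z : P.Fiber J := ⟨a, ha⟩
  let π : ((reindex P u).obj (⊤_ (P.Fiber I))).1 ⟶ one P I := pullbackMap (⊤_ (P.Fiber I)).2 u
  have hπ : P.IsCartesian u π := pullbackMap.IsCartesian (⊤_ (P.Fiber I)).2 u
  have ht : P.IsHomLift (𝟙 J) (t.from z).1 := (t.from z).2
  refine ⟨(t.from z).1 ≫ π, IsHomLift.comp_lift_id_left P u π (t.from z).1, ?_⟩
  intro f hf
  have : P.IsHomLift u f := hf
  have e : (⟨Functor.IsCartesian.map P u π f, inferInstance⟩ :
      z ⟶ (reindex P u).obj (⊤_ (P.Fiber I))) = t.from z := t.hom_ext _ _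
  rw [← e]
  exact (Functor.IsCartesian.fac P u π f).symm

/-- The cartesian functor `1 : B ⥤ X` choosing fibrewise terminal objects; it sends `u : J ⟶ I`
to the unique arrow `1_J ⟶ 1_I` over `u`. -/
noncomputable def oneFunctor [IsFibredTopos P] : B ⥤ X where
  obj I := one P I
  map {J I} u := (existsUnique_toOne P u (one P J) (one_proj P J)).choose
  map_id I := by
    have h := existsUnique_toOne P (𝟙 I) (one P I) (one_proj P I)
    exact h.unique h.choose_spec.1 (IsHomLift.id (one_proj P I))
  map_comp {K J I} u v := by
    have h := existsUnique_toOne P (u ≫ v) (one P K) (one_proj P K)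
    have := (existsUnique_toOne P u (one P K) (one_proj P K)).choose_spec.1
    have := (existsUnique_toOne P v (one P J) (one_proj P J)).choose_spec.1
    exact h.unique h.choose_spec.1 (IsHomLift.comp P u v _ _)

/-- The object `∐_I a` of the fibre over `1`, for `a` over `I`: the codomain of a chosen
cocartesian arrow `a ⟶ ∐_I a` over `I ⟶ 1`. -/
noncomputable def sumObj [HasTerminal B] [HasInternalSums P] (a : X) : X :=
  (HasInternalSums.exists_cocartesian (P := P) a (terminal.from (P.obj a))).choose

/-- The chosen cocartesian arrow `a ⟶ ∐_I a` over `I ⟶ 1`. -/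
noncomputable def sumInj [HasTerminal B] [HasInternalSums P] (a : X) : a ⟶ sumObj P a :=
  (HasInternalSums.exists_cocartesian (P := P) a (terminal.from (P.obj a))).choose_spec.choose

instance [HasTerminal B] [HasInternalSums P] (a : X) :
    P.IsStronglyCocartesian (terminal.from (P.obj a)) (sumInj P a) :=
  (HasInternalSums.exists_cocartesian (P := P) a
    (terminal.from (P.obj a))).choose_spec.choose_spec

lemma isHomLift_comp_sumInj [HasTerminal B] [HasInternalSums P] {a b : X} (f : a ⟶ b) :
    P.IsHomLift (terminal.from (P.obj a)) (f ≫ sumInj P b) := by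
  have h : P.IsHomLift (P.map f ≫ terminal.from (P.obj b)) (f ≫ sumInj P b) := inferInstance
  rwa [show P.map f ≫ terminal.from (P.obj b) = terminal.from (P.obj a) from
    Subsingleton.elim _ _] at h

/-- The arrow `∐ f` in the fibre over `1`: the unique vertical arrow with
`sumInj a ≫ ∐ f = f ≫ sumInj b`. -/
noncomputable def sumMap [HasTerminal B] [HasInternalSums P] {a b : X} (f : a ⟶ b) :
    sumObj P a ⟶ sumObj P b :=
  haveI := isHomLift_comp_sumInj P f
  Functor.IsStronglyCocartesian.map P (terminal.from (P.obj a)) (sumInj P a)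
    (g := 𝟙 (⊤_ B)) (Category.comp_id (terminal.from (P.obj a))).symm (f ≫ sumInj P b)

instance [HasTerminal B] [HasInternalSums P] {a b : X} (f : a ⟶ b) :
    P.IsHomLift (𝟙 (⊤_ B)) (sumMap P f) := by
  have := isHomLift_comp_sumInj P f
  unfold sumMap
  infer_instance

lemma sumInj_sumMap [HasTerminal B] [HasInternalSums P] {a b : X} (f : a ⟶ b) :
    sumInj P a ≫ sumMap P f = f ≫ sumInj P b := by
  have := isHomLift_comp_sumInj P f
  exact Functor.IsStronglyCocartesian.fac P (terminal.from (P.obj a)) (sumInj P a)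
    (Category.comp_id (terminal.from (P.obj a))).symm (f ≫ sumInj P b)

lemma sumObj_proj [HasTerminal B] [HasInternalSums P] (a : X) : P.obj (sumObj P a) = ⊤_ B :=
  IsHomLift.codomain_eq P (terminal.from (P.obj a)) (sumInj P a)

/-- The functor `X ⥤ X_1` sending `a` over `I` to `∐_I a`. -/
noncomputable def sumFunctor [HasTerminal B] [HasInternalSums P] : X ⥤ P.Fiber (⊤_ B) where
  obj a := ⟨sumObj P a, sumObj_proj P a⟩
  map f := ⟨sumMap P f, inferInstance⟩
  map_id a := by
    apply Subtype.ext
    have : P.IsHomLift (𝟙 (⊤_ B)) (𝟙 (sumObj P a)) := IsHomLift.id (sumObj_proj P a)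
    refine Functor.IsStronglyCocartesian.ext P (terminal.from (P.obj a)) (sumInj P a)
      (𝟙 (⊤_ B)) (ψ := sumMap P (𝟙 a)) (ψ' := 𝟙 (sumObj P a)) ?_
    simp [sumInj_sumMap]
  map_comp {a b c} f g := by
    apply Subtype.ext
    refine Functor.IsStronglyCocartesian.ext P (terminal.from (P.obj a)) (sumInj P a)
      (𝟙 (⊤_ B)) (ψ := sumMap P (f ≫ g)) (ψ' := sumMap P f ≫ sumMap P g) ?_
    rw [sumInj_sumMap, ← Category.assoc, sumInj_sumMap, Category.assoc, Category.assoc,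
      sumInj_sumMap]

/-- The functor `Δ : B ⥤ X_1`, `I ↦ ∐_I 1_I`. -/
noncomputable def Delta [HasTerminal B] [IsFibredTopos P] [HasInternalSums P] :
    B ⥤ P.Fiber (⊤_ B) :=
  oneFunctor P ⋙ sumFunctor P

end Delta

/-! ### Glueing and equivalence of fibrations -/

/-- The glueing `gl(F) : E ↓ F ⥤ B` of `F : B ⥤ E`: objects over `I` are arrows `A ⟶ F I`. -/
abbrev gl {E : Type u₃} [Category.{v₃} E] (F : B ⥤ E) : Comma (𝟭 E) F ⥤ B :=
  Comma.snd (𝟭 E) F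

/-- An equivalence in the 2-category of fibrations over `B`: functors over `B` in both directions
preserving cartesian arrows, mutually inverse up to natural isomorphisms with vertical
components. -/
structure FibredEquivalence {Y : Type u₃} [Category.{v₃} Y] (P : X ⥤ B) (Q : Y ⥤ B) where
  /-- the functor from `P` to `Q` -/
  functor : BasedFunctor (BasedCategory.ofFunctor P) (BasedCategory.ofFunctor Q)
  /-- the functor from `Q` to `P` -/
  inverse : BasedFunctor (BasedCategory.ofFunctor Q) (BasedCategory.ofFunctor P)
  functor_cart : ∀ {a b : X} (φ : a ⟶ b), IsCart P φ → IsCart Q (functor.map φ)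
  inverse_cart : ∀ {a b : Y} (φ : a ⟶ b), IsCart Q φ → IsCart P (inverse.map φ)
  /-- the unit -/
  unitIso : BasedFunctor.id _ ≅ functor.comp inverse
  /-- the counit -/
  counitIso : inverse.comp functor ≅ BasedFunctor.id _

end Fibrations

end FibTopos

/-! The total category has pullbacks because every arrow is vertical followed by cartesian.
Cartesian arrows pull back by lifting a base pullback, and vertical ones by using fibre pullbacks,
which are pullbacks in the whole total category since reindexing preserves them. The same pasting
shows that `P` preserves pullbacks.

Universality splits in the same way. Along cartesian arrows it is Beck–Chevalley. A vertical arrow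
`d ⟶ b` is its graph in the fibre product `b × d` followed by a projection. Along projections,
stability is Frobenius reciprocity (`IsCocart.of_isPullback_proj`): maps out of `b × d` are maps
from `b` into an exponential, and since reindexing is logical the exponential is universal for
objects over other base objects too. Along vertical monos, the subobject classifier makes pullback
along a cocartesian `φ : a ⟶ b` a bijection on vertical subobjects, so graphs of functions descend
from `a` to `b` (`IsCocart.of_isPullback_mono`).

For disjointness, write the diagonal as a cocartesian arrow followed by a vertical `m`.
Beck–Chevalley and universality make `m` monic, and a vertical mono that stays cocartesian after
composition with a cocartesian arrow is invertible (`IsCocart.isIso_of_mono`).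

Universality and disjointness together make sums commute with pullbacks (`IsCocart.pullback_map`)
and reflect isomorphisms. So `Δ` is left exact, and each `a` over `I` is the pullback of `∐ a ⟶ Δ I`
along `1_I ⟶ Δ I`. This recovers `a` from an object of the glueing, and universality shows that
every object of the glueing arises so. -/

namespace FibTopos

/-! ### Cartesian and cocartesian arrows -/

section CartesianArrows

variable {B : Type u₁} [Category.{v₁} B] {X : Type u₂} [Category.{v₂} X] {P : X ⥤ B}

lemma isHomLift_iff_map_eq {a b : X} (f : P.obj a ⟶ P.obj b) (φ : a ⟶ b) :
    P.IsHomLift f φ ↔ P.map φ = f :=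
  ⟨fun _ => (IsHomLift.eq_of_isHomLift P f φ).symm, fun h => h ▸ inferInstance⟩

/-- Stating the universal property with equations `P.map h = w` between images keeps later arguments
free of equalities between base objects. -/
lemma isCart_iff {a b : X} (φ : a ⟶ b) :
    IsCart P φ ↔ ∀ {z : X} (w : P.obj z ⟶ P.obj a) (g : z ⟶ b), P.map g = w ≫ P.map φ →
      ∃! h : z ⟶ a, P.map h = w ∧ h ≫ φ = g := by
  constructor
  · intro hφ z w g hg
    have : P.IsHomLift (w ≫ P.map φ) g := (isHomLift_iff_map_eq _ _).2 hg
    simpa only [isHomLift_iff_map_eq] using hφ.universal_property' w g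
  · intro h
    refine ⟨fun {z} w g hg => ?_⟩
    simpa only [isHomLift_iff_map_eq] using h w g ((isHomLift_iff_map_eq _ _).1 hg)

lemma isCocart_iff {a b : X} (φ : a ⟶ b) :
    IsCocart P φ ↔ ∀ {z : X} (w : P.obj b ⟶ P.obj z) (g : a ⟶ z), P.map g = P.map φ ≫ w →
      ∃! h : b ⟶ z, P.map h = w ∧ φ ≫ h = g := by
  constructor
  · intro hφ z w g hg
    have : P.IsHomLift (P.map φ ≫ w) g := (isHomLift_iff_map_eq _ _).2 hg
    simpa only [isHomLift_iff_map_eq] using hφ.universal_property' w g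
  · intro h
    refine ⟨fun {z} w g hg => ?_⟩
    simpa only [isHomLift_iff_map_eq] using h w g ((isHomLift_iff_map_eq _ _).1 hg)

lemma isCart_of_lift {a b : X} {I J : B} (u : I ⟶ J) (φ : a ⟶ b) [h : P.IsStronglyCartesian u φ] :
    IsCart P φ := by
  obtain ⟨⟩ := h.toIsHomLift
  exact h

lemma isCocart_of_lift {a b : X} {I J : B} (u : I ⟶ J) (φ : a ⟶ b)
    [h : P.IsStronglyCocartesian u φ] : IsCocart P φ := by
  obtain ⟨⟩ := h.toIsHomLift
  exact h

lemma IsCart.exists_lift {a b z : X} {φ : a ⟶ b} (hφ : IsCart P φ) (w : P.obj z ⟶ P.obj a)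
    (g : z ⟶ b) (hg : P.map g = w ≫ P.map φ) : ∃ h : z ⟶ a, P.map h = w ∧ h ≫ φ = g :=
  ((isCart_iff φ).1 hφ w g hg).exists

lemma IsCart.hom_ext {a b z : X} {φ : a ⟶ b} (hφ : IsCart P φ) {h h' : z ⟶ a}
    (hP : P.map h = P.map h') (he : h ≫ φ = h' ≫ φ) : h = h' :=
  ((isCart_iff φ).1 hφ (P.map h') (h' ≫ φ) (by simp)).unique ⟨hP, he⟩ ⟨rfl, rfl⟩

lemma IsCocart.exists_desc {a b z : X} {φ : a ⟶ b} (hφ : IsCocart P φ) (w : P.obj b ⟶ P.obj z)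
    (g : a ⟶ z) (hg : P.map g = P.map φ ≫ w) : ∃ h : b ⟶ z, P.map h = w ∧ φ ≫ h = g :=
  ((isCocart_iff φ).1 hφ w g hg).exists

lemma IsCocart.hom_ext {a b z : X} {φ : a ⟶ b} (hφ : IsCocart P φ) {h h' : b ⟶ z}
    (hP : P.map h = P.map h') (he : φ ≫ h = φ ≫ h') : h = h' :=
  ((isCocart_iff φ).1 hφ (P.map h') (φ ≫ h') (by simp)).unique ⟨hP, he⟩ ⟨rfl, rfl⟩

lemma isCart_of_isIso {a b : X} (φ : a ⟶ b) [IsIso φ] : IsCart P φ :=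
  (isCart_iff φ).2 fun w g hg => ⟨g ≫ inv φ, by simp [hg], fun h hh => by simp [← hh.2]⟩

lemma isCocart_of_isIso {a b : X} (φ : a ⟶ b) [IsIso φ] : IsCocart P φ :=
  (isCocart_iff φ).2 fun w g hg => ⟨inv φ ≫ g, by simp [hg], fun h hh => by simp [← hh.2]⟩

lemma IsCart.isIso {a b : X} {φ : a ⟶ b} (hφ : IsCart P φ) [IsIso (P.map φ)] : IsIso φ :=
  Functor.IsStronglyCartesian.isIso_of_base_isIso P (P.map φ) φ

lemma IsCocart.isIso {a b : X} {φ : a ⟶ b} (hφ : IsCocart P φ) [IsIso (P.map φ)] : IsIso φ := by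
  obtain ⟨h, hP, hh⟩ := hφ.exists_desc (inv (P.map φ)) (𝟙 a) (by simp)
  exact ⟨h, hh, hφ.hom_ext (by simp [hP]) (by simp [reassoc_of% hh])⟩

lemma IsCart.comp {a b c : X} {φ : a ⟶ b} {ψ : b ⟶ c} (hφ : IsCart P φ) (hψ : IsCart P ψ) :
    IsCart P (φ ≫ ψ) := by
  unfold IsCart
  rw [P.map_comp]
  infer_instance

lemma IsCocart.comp {a b c : X} {φ : a ⟶ b} {ψ : b ⟶ c} (hφ : IsCocart P φ)
    (hψ : IsCocart P ψ) : IsCocart P (φ ≫ ψ) := by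
  unfold IsCocart
  rw [P.map_comp]
  infer_instance

lemma IsCocart.of_comp {a b c : X} {φ : a ⟶ b} {ψ : b ⟶ c} (hφ : IsCocart P φ)
    (h : IsCocart P (φ ≫ ψ)) : IsCocart P ψ := by
  refine (isCocart_iff ψ).2 fun {z} w g hg => ?_
  obtain ⟨k, hk, hk'⟩ := h.exists_desc w (φ ≫ g) (by simp [hg])
  refine ⟨k, ⟨hk, hφ.hom_ext (by simp [hk, hg]) (by simpa using hk')⟩, ?_⟩
  rintro k' ⟨h₁, h₂⟩
  exact h.hom_ext (by rw [h₁, hk]) (by rw [hk', Category.assoc, h₂])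

/-- A commutative square with two opposite cartesian sides over a pullback square is a pullback. -/
lemma isPullback_of_isCart {a b c d : X} {φ' : c ⟶ d} {ψ' : c ⟶ a} {ψ : d ⟶ b} {φ : a ⟶ b}
    (w : φ' ≫ ψ = ψ' ≫ φ) (hψ : IsCart P ψ) (hψ' : IsCart P ψ')
    (h : IsPullback (P.map φ') (P.map ψ') (P.map ψ) (P.map φ)) : IsPullback φ' ψ' ψ φ := by
  refine ⟨⟨w⟩, ⟨PullbackCone.IsLimit.mk w
    (fun s => (hψ'.exists_lift (h.lift (P.map s.fst) (P.map s.snd)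
      (by simp only [← P.map_comp, s.condition])) s.snd (by simp)).choose) ?_ ?_ ?_⟩⟩
  · intro s
    generalize_proofs h₁ h₂
    obtain ⟨e₁, e₂⟩ := h₂.choose_spec
    refine hψ.hom_ext (by simp [e₁]) ?_
    rw [Category.assoc, w, reassoc_of% e₂, s.condition]
  · intro s
    generalize_proofs h₁ h₂
    exact h₂.choose_spec.2
  · intro s m hm₁ hm₂
    generalize_proofs h₁ h₂
    obtain ⟨e₁, e₂⟩ := h₂.choose_spec
    refine hψ'.hom_ext ?_ (by rw [hm₂, e₂])
    rw [e₁]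
    refine h.hom_ext (by simp [← P.map_comp, hm₁]) (by simp [← P.map_comp, hm₂])

/-- Cartesian arrows are stable under those pullbacks that are preserved by `P`. -/
lemma IsCart.of_isPullback {a b c d : X} {φ' : c ⟶ d} {ψ' : c ⟶ a} {ψ : d ⟶ b} {φ : a ⟶ b}
    (hψ : IsCart P ψ) (h : IsPullback φ' ψ' ψ φ)
    (hP : IsPullback (P.map φ') (P.map ψ') (P.map ψ) (P.map φ)) : IsCart P ψ' := by
  refine (isCart_iff ψ').2 fun {z} w g hg => ?_
  obtain ⟨k, hk, hk'⟩ := hψ.exists_lift (w ≫ P.map φ') (g ≫ φ)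
    (by simp only [P.map_comp, hg, Category.assoc, hP.w])
  refine ⟨h.lift k g hk', ⟨hP.hom_ext ?_ ?_, by simp⟩, ?_⟩
  · rw [← P.map_comp, h.lift_fst, hk]
  · rw [← P.map_comp, h.lift_snd, hg]
  · rintro l ⟨h₁, h₂⟩
    refine h.hom_ext ?_ (by simpa using h₂)
    rw [h.lift_fst]
    refine hψ.hom_ext (by simp [h₁, hk]) ?_
    rw [Category.assoc, h.w, reassoc_of% h₂, hk']

section Fibered

variable (P) [P.IsFibered]

/-- The domain of a lift lies over `J` by an equality of objects; weakening it to the isomorphism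
`e` lets squares be compared up to isomorphism. -/
lemma exists_isCart (b : X) {J : B} (u : J ⟶ P.obj b) :
    ∃ (a : X) (e : P.obj a ≅ J) (φ : a ⟶ b), P.map φ = e.hom ≫ u ∧ IsCart P φ := by
  have hP : P.IsStronglyCartesian u (Functor.IsPreFibered.pullbackMap (p := P) rfl u) :=
    inferInstance
  refine ⟨_, eqToIso (Functor.IsPreFibered.pullbackObj_proj (p := P) rfl u), _, ?_,
    isCart_of_lift u (Functor.IsPreFibered.pullbackMap (p := P) rfl u)⟩
  rw [IsHomLift.fac' P u (Functor.IsPreFibered.pullbackMap (p := P) rfl u)]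
  simp

/-- Every arrow factors as a vertical arrow followed by a cartesian one. -/
lemma exists_vert_cart_factorization {a b : X} (f : a ⟶ b) :
    ∃ (c : X) (v : a ⟶ c) (κ : c ⟶ b), IsIso (P.map v) ∧ IsCart P κ ∧ v ≫ κ = f := by
  obtain ⟨c, e, κ, hκ, hκ'⟩ := exists_isCart P b (P.map f)
  obtain ⟨v, hv, hv'⟩ := hκ'.exists_lift e.inv f (by simp [hκ])
  exact ⟨c, v, κ, hv ▸ inferInstance, hκ', hv'⟩

end Fibered

end CartesianArrows

/-! ### Reindexing, and pullbacks in the total category -/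

section Reindexing

variable {B : Type u₁} [Category.{v₁} B] {X : Type u₂} [Category.{v₂} X] (P : X ⥤ B)

/-- The inclusion of the fibre over `I` into the total category. -/
abbrev incl (I : B) : P.Fiber I ⥤ X := Functor.Fiber.fiberInclusion

/-- The cartesian arrow `u^* a ⟶ a` over `u`. -/
noncomputable def reindexMap [P.IsFibered] {J I : B} (u : J ⟶ I) (a : P.Fiber I) :
    (incl P J).obj ((reindex P u).obj a) ⟶ (incl P I).obj a :=
  Functor.IsPreFibered.pullbackMap a.2 u

instance reindexMap_isCartesian [P.IsFibered] {J I : B} (u : J ⟶ I) (a : P.Fiber I) :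
    P.IsCartesian u (reindexMap P u a) :=
  Functor.IsPreFibered.pullbackMap.IsCartesian a.2 u

lemma reindexMap_isCart [P.IsFibered] {J I : B} (u : J ⟶ I) (a : P.Fiber I) :
    IsCart P (reindexMap P u a) :=
  isCart_of_lift u _

lemma reindexMap_naturality [P.IsFibered] {J I : B} (u : J ⟶ I) {a b : P.Fiber I} (α : a ⟶ b) :
    (incl P J).map ((reindex P u).map α) ≫ reindexMap P u b =
      reindexMap P u a ≫ (incl P I).map α :=
  haveI := α.2
  Functor.IsCartesian.fac P u (Functor.IsPreFibered.pullbackMap b.2 u)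
    (Functor.IsPreFibered.pullbackMap a.2 u ≫ α.1)

lemma existsUnique_reindex_lift [P.IsFibered] {J I : B} (u : J ⟶ I) (a : P.Fiber I)
    (z : P.Fiber J) (x : (incl P J).obj z ⟶ (incl P I).obj a) (hx : P.IsHomLift u x) :
    ∃! y : z ⟶ (reindex P u).obj a, (incl P J).map y ≫ reindexMap P u a = x := by
  obtain ⟨y, ⟨hy, hy'⟩, hu⟩ :=
    Functor.IsCartesian.universal_property (p := P) (f := u) (φ := reindexMap P u a) x
  exact ⟨⟨y, hy⟩, hy', fun y' h => Subtype.ext (hu _ ⟨y'.2, h⟩)⟩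

lemma reindex_hom_ext [P.IsFibered] {J I : B} {u : J ⟶ I} {a : P.Fiber I}
    {z : P.Fiber J} {x y : z ⟶ (reindex P u).obj a}
    (h : (incl P J).map x ≫ reindexMap P u a = (incl P J).map y ≫ reindexMap P u a) : x = y :=
  (existsUnique_reindex_lift P u a z ((incl P J).map y ≫ reindexMap P u a) (by
    infer_instance)).unique h rfl

variable {P}

lemma isHomLift_unique {I J : B} {a b : X} (φ : a ⟶ b) {f g : I ⟶ J} (hf : P.IsHomLift f φ)
    (hg : P.IsHomLift g φ) : f = g := by
  obtain ⟨⟩ := hf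
  exact IsHomLift.eq_of_isHomLift P g φ |>.symm

lemma isHomLift_of_comp_vert {I J : B} {a b c : X} {f : I ⟶ J} {φ : a ⟶ b} {ψ : b ⟶ c}
    (hψ : P.IsHomLift (𝟙 J) ψ) (h : P.IsHomLift f (φ ≫ ψ)) : P.IsHomLift f φ := by
  obtain rfl := IsHomLift.domain_eq P f (φ ≫ ψ)
  obtain rfl := IsHomLift.domain_eq P (𝟙 J) ψ
  have h' : P.IsHomLift (P.map φ) (φ ≫ ψ) := inferInstance
  obtain rfl := isHomLift_unique _ h h'
  infer_instance

lemma isIso_map_of_isHomLift {I J : B} {a b : X} (f : I ⟶ J) [IsIso f] (φ : a ⟶ b)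
    [h : P.IsHomLift f φ] : IsIso (P.map φ) := by
  rw [IsHomLift.fac' P f φ]
  infer_instance

instance isIso_map_incl {I : B} {a b : P.Fiber I} (f : a ⟶ b) :
    IsIso (P.map ((incl P I).map f)) :=
  isIso_map_of_isHomLift (𝟙 I) _

lemma exists_isHomLift_incl {I J : B} {z : P.Fiber J} {a : P.Fiber I}
    (x : (incl P J).obj z ⟶ (incl P I).obj a) : ∃ u : J ⟶ I, P.IsHomLift u x :=
  ⟨eqToHom z.2.symm ≫ P.map x ≫ eqToHom a.2, IsHomLift.of_fac P _ _ z.2 a.2 rfl⟩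

/-- As `h` and `k` are vertical, `x` and `y` lie over the same `u`. They then correspond to arrows
into the reindexed objects, where the square is still a pullback because `u^*` is left exact. -/
lemma existsUnique_incl_lift [IsFibredTopos P] {I : B} {a b c d : P.Fiber I} {f : a ⟶ b}
    {g : a ⟶ c} {h : b ⟶ d} {k : c ⟶ d} (H : IsPullback f g h k) {J : B} (z : P.Fiber J)
    (x : (incl P J).obj z ⟶ (incl P I).obj b) (y : (incl P J).obj z ⟶ (incl P I).obj c)
    (w : x ≫ (incl P I).map h = y ≫ (incl P I).map k) :
    ∃! l : (incl P J).obj z ⟶ (incl P I).obj a,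
      l ≫ (incl P I).map f = x ∧ l ≫ (incl P I).map g = y := by
  refine existsUnique_of_exists_of_unique ?_ ?_
  · obtain ⟨u, hx⟩ := exists_isHomLift_incl x
    have hy : P.IsHomLift u y := by
      refine isHomLift_of_comp_vert (ψ := (incl P I).map k) inferInstance ?_
      rw [← w]
      infer_instance
    have hF := H.map (reindex P u)
    obtain ⟨x', hx', -⟩ := existsUnique_reindex_lift P u b z x hx
    obtain ⟨y', hy', -⟩ := existsUnique_reindex_lift P u c z y hy
    have e : x' ≫ (reindex P u).map h = y' ≫ (reindex P u).map k := by
      apply reindex_hom_ext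
      rw [Functor.map_comp, Functor.map_comp, Category.assoc, Category.assoc,
        reindexMap_naturality, reindexMap_naturality, reassoc_of% hx', reassoc_of% hy', w]
    refine ⟨(incl P _).map (hF.lift x' y' e) ≫ reindexMap P u a, ?_, ?_⟩
    · rw [Category.assoc, ← reindexMap_naturality, ← hx', ← Category.assoc, ← Functor.map_comp,
        hF.lift_fst]
    · rw [Category.assoc, ← reindexMap_naturality, ← hy', ← Category.assoc, ← Functor.map_comp,
        hF.lift_snd]
  · rintro l m ⟨e₁, e₂⟩ ⟨hm₁, hm₂⟩
    obtain ⟨u, hm⟩ := exists_isHomLift_incl m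
    have hl : P.IsHomLift u l := by
      refine isHomLift_of_comp_vert (ψ := (incl P I).map f) inferInstance ?_
      rw [e₁, ← hm₁]
      infer_instance
    have hF := H.map (reindex P u)
    obtain ⟨m', hm', -⟩ := existsUnique_reindex_lift P u a z m hm
    obtain ⟨l', hl', -⟩ := existsUnique_reindex_lift P u a z l hl
    suffices m' = l' by rw [← hm', this, hl']
    refine hF.hom_ext (reindex_hom_ext P ?_) (reindex_hom_ext P ?_)
    · rw [Functor.map_comp, Functor.map_comp, Category.assoc, Category.assoc,
        reindexMap_naturality, reassoc_of% hm', reassoc_of% hl', hm₁, e₁]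
    · rw [Functor.map_comp, Functor.map_comp, Category.assoc, Category.assoc,
        reindexMap_naturality, reassoc_of% hm', reassoc_of% hl', hm₂, e₂]

/-- The fibre over the image of `c` has an object with underlying object `c`. -/
abbrev fiberObj (P : X ⥤ B) (c : X) : P.Fiber (P.obj c) := Functor.Fiber.mk rfl

lemma isPullback_of_existsUnique {p a b c : X} {π₁ : p ⟶ a} {π₂ : p ⟶ b} {f : a ⟶ c}
    {g : b ⟶ c} (w : π₁ ≫ f = π₂ ≫ g)
    (h : ∀ {z : X} (x : z ⟶ a) (y : z ⟶ b), x ≫ f = y ≫ g →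
      ∃! l : z ⟶ p, l ≫ π₁ = x ∧ l ≫ π₂ = y) : IsPullback π₁ π₂ f g :=
  ⟨⟨w⟩, ⟨PullbackCone.IsLimit.mk w (fun s => (h s.fst s.snd s.condition).choose)
    (fun s => (h s.fst s.snd s.condition).choose_spec.1.1)
    (fun s => (h s.fst s.snd s.condition).choose_spec.1.2)
    (fun s m h₁ h₂ => (h s.fst s.snd s.condition).choose_spec.2 m ⟨h₁, h₂⟩)⟩⟩

/-- A pullback square in a fibre is a pullback square in the total category. -/
lemma isPullback_incl [IsFibredTopos P] {I : B} {a b c d : P.Fiber I} {f : a ⟶ b} {g : a ⟶ c}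
    {h : b ⟶ d} {k : c ⟶ d} (H : IsPullback f g h k) :
    IsPullback ((incl P I).map f) ((incl P I).map g) ((incl P I).map h) ((incl P I).map k) :=
  isPullback_of_existsUnique (by rw [← Functor.map_comp, H.w, Functor.map_comp])
    fun {z} x y w => existsUnique_incl_lift H (fiberObj P z) x y w

/-- Membership in a fibre is an equality of objects, so an object lying over an isomorphic base
object has to be moved. A cartesian arrow over the isomorphism `inv u` does this, being itself
invertible. -/
lemma exists_fiber_iso_of_isHomLift [P.IsFibered] {J : B} {A : P.Fiber J} {c : X}
    (f : (incl P J).obj A ⟶ c) (u : J ⟶ P.obj c) [IsIso u] [h : P.IsHomLift u f] :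
    ∃ (A' : P.Fiber (P.obj c)) (α : (incl P _).obj A' ≅ (incl P J).obj A),
      P.IsHomLift (𝟙 (P.obj c)) (α.hom ≫ f) := by
  have : IsIso (P.map (reindexMap P (inv u) A)) := isIso_map_of_isHomLift (inv u) _
  have : IsIso (reindexMap P (inv u) A) := (reindexMap_isCart P (inv u) A).isIso
  refine ⟨(reindex P (inv u)).obj A, asIso (reindexMap P (inv u) A), ?_⟩
  have h : P.IsHomLift (inv u ≫ u) (reindexMap P (inv u) A ≫ f) := inferInstance
  rwa [IsIso.inv_hom_id] at h

/-- An object vertical over `c` may be replaced by one in the fibre of `c`. -/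
lemma exists_fiber_iso [P.IsFibered] {a c : X} (f : a ⟶ c) [IsIso (P.map f)] :
    ∃ (A : P.Fiber (P.obj c)) (α : (incl P _).obj A ≅ a),
      P.IsHomLift (𝟙 (P.obj c)) (α.hom ≫ f) :=
  exists_fiber_iso_of_isHomLift (A := fiberObj P a) (u := P.map f)
    (h := IsHomLift.map P f) f

variable (P) in
/-- The cospan `f, g` has a pullback that is preserved by `P`. -/
def HasPreservedPullback {a b c : X} (f : a ⟶ c) (g : b ⟶ c) : Prop :=
  ∃ (p : X) (π₁ : p ⟶ a) (π₂ : p ⟶ b), IsPullback π₁ π₂ f g ∧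
    IsPullback (P.map π₁) (P.map π₂) (P.map f) (P.map g)

lemma hasPreservedPullback_of_vert [IsFibredTopos P] {a b c : X} (f : a ⟶ c) (g : b ⟶ c)
    [IsIso (P.map f)] [IsIso (P.map g)] : HasPreservedPullback P f g := by
  obtain ⟨A, α, hα⟩ := exists_fiber_iso (P := P) f
  obtain ⟨A', β, hβ⟩ := exists_fiber_iso (P := P) g
  let F : A ⟶ fiberObj P c := ⟨_, hα⟩
  let G : A' ⟶ fiberObj P c := ⟨_, hβ⟩
  have h := isPullback_incl (IsPullback.of_hasPullback F G)
  have h' : IsPullback ((incl P _).map (pullback.fst F G) ≫ α.hom)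
      ((incl P _).map (pullback.snd F G) ≫ β.hom) f g :=
    IsPullback.of_iso h (Iso.refl _) α β (Iso.refl _) (by simp) (by simp)
      ((Category.comp_id _).trans rfl) ((Category.comp_id _).trans rfl)
  refine ⟨_, _, _, h', ?_⟩
  have : IsIso (P.map ((incl P _).map (pullback.fst F G) ≫ α.hom)) := by
    rw [P.map_comp]
    infer_instance
  exact IsPullback.of_horiz_isIso ⟨by rw [← P.map_comp, ← P.map_comp, h'.w]⟩

/-- The base pullback is lifted: one projection is a cartesian lift ending at `a`, the other is
induced by cartesianness of `g`. -/
lemma hasPreservedPullback_of_isCart [HasPullbacks B] [P.IsFibered] {a b c : X} (f : a ⟶ c)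
    (g : b ⟶ c) (hg : IsCart P g) : HasPreservedPullback P f g := by
  obtain ⟨p, e, π₁, hπ₁, hc⟩ := exists_isCart P a (pullback.fst (P.map f) (P.map g))
  obtain ⟨π₂, hπ₂, hw⟩ := hg.exists_lift (e.hom ≫ pullback.snd (P.map f) (P.map g)) (π₁ ≫ f)
    (by simp [hπ₁, pullback.condition])
  have hP : IsPullback (P.map π₁) (P.map π₂) (P.map f) (P.map g) := by
    refine IsPullback.of_iso (IsPullback.of_hasPullback (P.map f) (P.map g)) e.symm
      (Iso.refl _) (Iso.refl _) (Iso.refl _) (by simp [hπ₁]) (by simp [hπ₂]) (by simp) (by simp)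
  exact ⟨p, π₁, π₂, (isPullback_of_isCart hw hg hc hP.flip).flip, hP⟩

lemma HasPreservedPullback.symm {a b c : X} {f : a ⟶ c} {g : b ⟶ c}
    (h : HasPreservedPullback P f g) : HasPreservedPullback P g f := by
  obtain ⟨p, π₁, π₂, h₁, h₂⟩ := h
  exact ⟨p, π₂, π₁, h₁.flip, h₂.flip⟩

/-- Pasting of pullbacks. The second hypothesis is handed the base pullback so that verticality of
`f` can be passed on to `π₂`. -/
lemma HasPreservedPullback.comp {a b c d : X} {f : a ⟶ c} {g : b ⟶ c} {k : d ⟶ b}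
    (h : HasPreservedPullback P f g)
    (h' : ∀ {p : X} (π₁ : p ⟶ a) (π₂ : p ⟶ b),
      IsPullback (P.map π₁) (P.map π₂) (P.map f) (P.map g) → HasPreservedPullback P π₂ k) :
    HasPreservedPullback P f (k ≫ g) := by
  obtain ⟨p, π₁, π₂, h₁, h₂⟩ := h
  obtain ⟨q, ρ₁, ρ₂, h₃, h₄⟩ := h' π₁ π₂ h₂
  refine ⟨q, ρ₁ ≫ π₁, ρ₂, (h₃.flip.paste_vert h₁.flip).flip, ?_⟩
  have := (h₄.flip.paste_vert h₂.flip).flip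
  rwa [← P.map_comp, ← P.map_comp] at this

lemma hasPreservedPullback_vert_left [HasPullbacks B] [IsFibredTopos P] {a b c : X} (v : a ⟶ c)
    (f : b ⟶ c) [IsIso (P.map v)] : HasPreservedPullback P v f := by
  obtain ⟨c', w, κ, hw, hκ, rfl⟩ := exists_vert_cart_factorization P f
  refine (hasPreservedPullback_of_isCart v κ hκ).comp fun π₁ π₂ h => ?_
  have := h.isIso_snd_of_isIso
  exact hasPreservedPullback_of_vert π₂ w

lemma hasPreservedPullback [HasPullbacks B] [IsFibredTopos P] {a b c : X} (f : a ⟶ c)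
    (g : b ⟶ c) : HasPreservedPullback P f g := by
  obtain ⟨c', w, κ, hw, hκ, rfl⟩ := exists_vert_cart_factorization P g
  exact (hasPreservedPullback_of_isCart f κ hκ).comp fun π₁ π₂ h =>
    (hasPreservedPullback_vert_left w π₂).symm

variable (P) in
/-- The total category of a fibred topos has pullbacks. -/
lemma hasPullbacks_total [HasPullbacks B] [IsFibredTopos P] : HasPullbacks X := by
  have : ∀ {a b c : X} {f : a ⟶ c} {g : b ⟶ c}, HasLimit (cospan f g) := by
    intro a b c f g
    obtain ⟨p, π₁, π₂, h, -⟩ := hasPreservedPullback (P := P) f g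
    exact h.hasPullback
  exact hasPullbacks_of_hasLimit_cospan X

variable (P) in
/-- The projection of a fibred topos preserves pullbacks. -/
lemma map_isPullback [HasPullbacks B] [IsFibredTopos P] {p a b c : X} {π₁ : p ⟶ a} {π₂ : p ⟶ b}
    {f : a ⟶ c} {g : b ⟶ c} (h : IsPullback π₁ π₂ f g) :
    IsPullback (P.map π₁) (P.map π₂) (P.map f) (P.map g) := by
  obtain ⟨q, ρ₁, ρ₂, h', hP⟩ := hasPreservedPullback (P := P) f g
  refine IsPullback.of_iso hP (P.mapIso (h'.isoIsPullback _ _ h)) (Iso.refl _) (Iso.refl _)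
    (Iso.refl _) ?_ ?_ (by simp) (by simp)
  · simp [← P.map_comp]
  · simp [← P.map_comp]

end Reindexing

/-! ### Fibrewise terminal objects and products -/

section FibrewiseStructure

variable {B : Type u₁} [Category.{v₁} B] {X : Type u₂} [Category.{v₂} X] {P : X ⥤ B}

variable (P) in
/-- `T` is terminal in its fibre, in a way that is stable under reindexing. -/
def IsOne (T : X) : Prop :=
  ∀ ⦃a : X⦄ (u : P.obj a ⟶ P.obj T), ∃! f : a ⟶ T, P.map f = u

lemma IsOne.hom_ext {T a : X} (hT : IsOne P T) {f g : a ⟶ T} (h : P.map f = P.map g) : f = g :=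
  (hT (P.map g)).unique h rfl

variable (P) in
lemma isOne_one [IsFibredTopos P] (I : B) : IsOne P (one P I) := by
  intro a u
  have h (f : a ⟶ one P I) : P.IsHomLift (u ≫ eqToHom (one_proj P I)) f ↔ P.map f = u := by
    constructor
    · intro hf
      simpa using IsHomLift.fac' P (u ≫ eqToHom (one_proj P I)) f
    · intro hf
      exact IsHomLift.of_fac P _ _ rfl (one_proj P I) (by simp [hf])
  simpa only [h] using existsUnique_toOne P (u ≫ eqToHom (one_proj P I)) a rfl

variable (P) in
-- Working with arrows into such a `T` replaces working in a fibre: equality of arrows into `T` can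
-- be tested in the base.
lemma exists_isOne [IsFibredTopos P] (b : X) :
    ∃ (T : X) (t : b ⟶ T), IsOne P T ∧ IsIso (P.map t) := by
  obtain ⟨t, ht, -⟩ := isOne_one P (P.obj b) (eqToHom (one_proj P (P.obj b)).symm : P.obj b ⟶ _)
  exact ⟨_, t, isOne_one P _, ht ▸ inferInstance⟩

lemma obj_incl_obj {I : B} (a : P.Fiber I) : P.obj ((incl P I).obj a) = I := a.2

lemma map_incl_map {I : B} {a b : P.Fiber I} (f : a ⟶ b) :
    P.map ((incl P I).map f) = eqToHom ((obj_incl_obj a).trans (obj_incl_obj b).symm) := by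
  rw [IsHomLift.fac' P (𝟙 I) ((incl P I).map f)]
  simp

lemma IsOne.exists_hom {I : B} {T : P.Fiber I} (hT : IsOne P ((incl P I).obj T))
    (A : P.Fiber I) : ∃ f : (incl P I).obj A ⟶ (incl P I).obj T, P.IsHomLift (𝟙 I) f := by
  obtain ⟨f, hf, -⟩ := hT (a := (incl P I).obj A)
    (eqToHom ((obj_incl_obj A).trans (obj_incl_obj T).symm))
  exact ⟨f, IsHomLift.of_fac' P _ _ (obj_incl_obj A) (obj_incl_obj T) (by simp [hf])⟩

/-- An object which is terminal in the sense of `IsOne` is terminal in its fibre. -/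
noncomputable def IsOne.isTerminal {I : B} {T : P.Fiber I} (hT : IsOne P ((incl P I).obj T)) :
    IsTerminal T :=
  IsTerminal.ofUniqueHom (Y := T)
    (fun A => ⟨(hT.exists_hom A).choose, (hT.exists_hom A).choose_spec⟩)
    (fun _ _ => Subtype.ext (hT.hom_ext ((map_incl_map _).trans (map_incl_map _).symm)))

/-- Two opposite sides are cartesian and the other two are vertical, so the image in the base is
trivially a pullback. -/
lemma reindexMap_isPullback [P.IsFibered] {J I : B} (u : J ⟶ I) {a b : P.Fiber I} (α : a ⟶ b) :
    IsPullback ((incl P J).map ((reindex P u).map α)) (reindexMap P u a) (reindexMap P u b)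
      ((incl P I).map α) :=
  isPullback_of_isCart (reindexMap_naturality P u α) (reindexMap_isCart P u b)
    (reindexMap_isCart P u a) (IsPullback.of_horiz_isIso
      ⟨by rw [← P.map_comp, reindexMap_naturality, P.map_comp]⟩)

lemma isPullback_incl_prod [IsFibredTopos P] {I : B} {T A D : P.Fiber I} (hT : IsTerminal T)
    (a : A ⟶ T) (d : D ⟶ T) :
    IsPullback ((incl P I).map (prod.snd : D ⨯ A ⟶ A)) ((incl P I).map (prod.fst : D ⨯ A ⟶ D))
      ((incl P I).map a) ((incl P I).map d) := by
  have h : IsPullback (prod.fst : D ⨯ A ⟶ D) prod.snd (hT.from D) (hT.from A) :=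
    IsPullback.of_is_product' (prodIsProd D A) hT
  rw [hT.hom_ext (hT.from D) d, hT.hom_ext (hT.from A) a] at h
  exact isPullback_incl h.flip

/-- A pullback square in the total category between objects of a fibre is a pullback square in
the fibre. -/
lemma isPullback_of_incl [IsFibredTopos P] {I : B} {a b c d : P.Fiber I} {f : a ⟶ b}
    {g : a ⟶ c} {h : b ⟶ d} {k : c ⟶ d}
    (H : IsPullback ((incl P I).map f) ((incl P I).map g) ((incl P I).map h)
      ((incl P I).map k)) : IsPullback f g h k := by
  have w : f ≫ h = g ≫ k := (incl P I).map_injective (by simpa using H.w)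
  have H' := isPullback_incl (IsPullback.of_hasPullback h k)
  have e : (incl P I).map (pullback.lift f g w) = (H.isoIsPullback _ _ H').hom := by
    refine H'.hom_ext ?_ ?_
    · rw [IsPullback.isoIsPullback_hom_fst, ← Functor.map_comp, pullback.lift_fst]
    · rw [IsPullback.isoIsPullback_hom_snd, ← Functor.map_comp, pullback.lift_snd]
  have : IsIso ((incl P I).map (pullback.lift f g w)) := e ▸ inferInstance
  have : IsIso (pullback.lift f g w) := isIso_of_reflects_iso _ (incl P I)
  exact IsPullback.of_iso (IsPullback.of_hasPullback h k) (asIso (pullback.lift f g w)).symm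
    (Iso.refl _) (Iso.refl _) (Iso.refl _) (by simpa using pullback.lift_fst f g w)
    (by simpa using pullback.lift_snd f g w) (by simp) (by simp)

end FibrewiseStructure

/-! ### Exponentials universal for the total category -/

section Exponentials

variable {B : Type u₁} [Category.{v₁} B] {X : Type u₂} [Category.{v₂} X] {P : X ⥤ B}

/-- Logicality makes `u^* E` an exponential in the fibre over `J`, and arrows over `u` into `E` are
arrows of that fibre into `u^* E`. The quantified `l` stands for the arrow induced on products by
`h`; describing it by its projections avoids naming the product comparison. -/
lemma existsUnique_exponential_transpose [IsFibredTopos P] {I J : B} (u : J ⟶ I)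
    {T D E Z : P.Fiber I} (hT : IsTerminal T) (ev : D ⨯ E ⟶ Z) (hev : IsExponential ev)
    (A : P.Fiber J)
    (g : (incl P J).obj ((reindex P u).obj D ⨯ A) ⟶ (incl P I).obj Z) (hg : P.IsHomLift u g) :
    ∃! h : (incl P J).obj A ⟶ (incl P I).obj E, P.IsHomLift u h ∧
      ∀ l : (incl P J).obj ((reindex P u).obj D ⨯ A) ⟶ (incl P I).obj (D ⨯ E),
        l ≫ (incl P I).map prod.fst = (incl P J).map prod.fst ≫ reindexMap P u D →
        l ≫ (incl P I).map prod.snd = (incl P J).map prod.snd ≫ h →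
          l ≫ (incl P I).map ev = g := by
  let c := inv (prodComparison (reindex P u) D E)
  have hev' : IsExponential (c ≫ (reindex P u).map ev) :=
    IsLogical.exponential (F := reindex P u) ev hev _ (by simp [c])
  obtain ⟨g₁, hg₁, -⟩ := existsUnique_reindex_lift P u Z _ g hg
  obtain ⟨h₁, hh₁, hu⟩ := hev' A g₁
  have key₁ (k : A ⟶ (reindex P u).obj E) :
      ((incl P J).map (prod.map (𝟙 _) k ≫ c) ≫ reindexMap P u (D ⨯ E)) ≫
        (incl P I).map prod.fst = (incl P J).map prod.fst ≫ reindexMap P u D := by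
    rw [Category.assoc, ← reindexMap_naturality, ← Functor.map_comp_assoc, Category.assoc,
      inv_prodComparison_map_fst, prod.map_fst, Category.comp_id]
  have key₂ (k : A ⟶ (reindex P u).obj E) :
      ((incl P J).map (prod.map (𝟙 _) k ≫ c) ≫ reindexMap P u (D ⨯ E)) ≫
        (incl P I).map prod.snd = (incl P J).map prod.snd ≫ (incl P J).map k ≫
          reindexMap P u E := by
    rw [Category.assoc, ← reindexMap_naturality, ← Functor.map_comp_assoc, Category.assoc,
      inv_prodComparison_map_snd, prod.map_snd, Functor.map_comp, Category.assoc]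
  have key₃ (k : A ⟶ (reindex P u).obj E) :
      ((incl P J).map (prod.map (𝟙 _) k ≫ c) ≫ reindexMap P u (D ⨯ E)) ≫
        (incl P I).map ev =
      (incl P J).map (prod.map (𝟙 _) k ≫ c ≫ (reindex P u).map ev) ≫ reindexMap P u Z := by
    rw [Category.assoc, ← reindexMap_naturality, ← Functor.map_comp_assoc, Category.assoc]
  refine ⟨(incl P J).map h₁ ≫ reindexMap P u E, ⟨inferInstance, fun l hl₁ hl₂ => ?_⟩, ?_⟩
  · have : l = (incl P J).map (prod.map (𝟙 _) h₁ ≫ c) ≫ reindexMap P u (D ⨯ E) := by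
      refine (isPullback_incl_prod hT (hT.from E) (hT.from D)).hom_ext ?_ ?_
      · rw [hl₂, key₂]
      · rw [hl₁, key₁]
    rw [this, key₃, hh₁, hg₁]
  · rintro k ⟨hk, hk'⟩
    obtain ⟨k₁, rfl, -⟩ := existsUnique_reindex_lift P u E _ k hk
    have := hk' _ (key₁ k₁) (key₂ k₁)
    rw [key₃] at this
    rw [hu k₁ (reindex_hom_ext P (this.trans hg₁.symm))]

variable (P) in
/-- The exponential of `z` by `d` exists among the objects vertical over `T`, and its universal
property holds with respect to all arrows into `T`. -/
def HasExponentialOver {T d z : X} (δ : d ⟶ T) (ζ : z ⟶ T) : Prop :=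
  ∃ (e ed : X) (ε : e ⟶ T) (π₁ : ed ⟶ e) (π₂ : ed ⟶ d) (ev : ed ⟶ z),
    IsIso (P.map ε) ∧ IsPullback π₁ π₂ ε δ ∧ ev ≫ ζ = π₁ ≫ ε ∧
    ∀ {x xd : X} (s : x ⟶ T) (ρ₁ : xd ⟶ x) (ρ₂ : xd ⟶ d), IsPullback ρ₁ ρ₂ s δ →
      ∀ g : xd ⟶ z, g ≫ ζ = ρ₁ ≫ s → ∃! h : x ⟶ e, h ≫ ε = s ∧
        ∀ l : xd ⟶ ed, l ≫ π₁ = ρ₁ ≫ h → l ≫ π₂ = ρ₂ → l ≫ ev = g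

/-- The product square in the fibre over `J` is pasted with the reindexing square of `D ⟶ T`. -/
lemma isPullback_reindex_prod [IsFibredTopos P] {I J : B} (u : J ⟶ I) {T D : P.Fiber I}
    (hT : IsTerminal T) (A : P.Fiber J) (s : (incl P J).obj A ⟶ (incl P I).obj T)
    (hs : P.IsHomLift u s) :
    IsPullback ((incl P J).map (prod.snd : (reindex P u).obj D ⨯ A ⟶ A))
      ((incl P J).map prod.fst ≫ reindexMap P u D) s ((incl P I).map (hT.from D)) := by
  obtain ⟨s', rfl, -⟩ := existsUnique_reindex_lift P u T A s hs
  exact (isPullback_incl_prod (IsTerminal.isTerminalObj (reindex P u) _ hT) s'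
    ((reindex P u).map (hT.from D))).paste_vert (reindexMap_isPullback u (hT.from D))

lemma existsUnique_exponential_incl [IsFibredTopos P] {I J : B} {T D E Z : P.Fiber I}
    (hT : IsTerminal T) (ev : D ⨯ E ⟶ Z) (hev : IsExponential ev) {A : P.Fiber J}
    {d z xd : X} (α : (incl P I).obj D ≅ d)
    (β : (incl P I).obj Z ≅ z) {δ : d ⟶ (incl P I).obj T} {ζ : z ⟶ (incl P I).obj T}
    (hδ : α.hom ≫ δ = (incl P I).map (hT.from D)) (hζ : β.hom ≫ ζ = (incl P I).map (hT.from Z))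
    (s : (incl P J).obj A ⟶ (incl P I).obj T) (ρ₁ : xd ⟶ (incl P J).obj A) (ρ₂ : xd ⟶ d)
    (H : IsPullback ρ₁ ρ₂ s δ) (g : xd ⟶ z) (hg : g ≫ ζ = ρ₁ ≫ s)
    (hs : ∀ f : (incl P J).obj A ⟶ (incl P I).obj T, P.map f = P.map s → f = s) :
    ∃! h : (incl P J).obj A ⟶ (incl P I).obj E, h ≫ (incl P I).map (hT.from E) = s ∧
      ∀ l : xd ⟶ (incl P I).obj (D ⨯ E), l ≫ (incl P I).map prod.snd = ρ₁ ≫ h →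
        l ≫ (incl P I).map prod.fst ≫ α.hom = ρ₂ → l ≫ (incl P I).map ev ≫ β.hom = g := by
  obtain ⟨u, hu⟩ := exists_isHomLift_incl s
  have H₀ := isPullback_reindex_prod (D := D) u hT A s hu
  have H₁ : IsPullback ((incl P J).map (prod.snd : (reindex P u).obj D ⨯ A ⟶ A))
      (((incl P J).map prod.fst ≫ reindexMap P u D) ≫ α.hom) s δ :=
    IsPullback.of_iso H₀ (Iso.refl _) (Iso.refl _) α (Iso.refl _) (by simp) (by simp) (by simp)
      (by simp [hδ])
  -- The given pullback is identified with the fibre product `u^* D ⨯ A`, where transposition is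
  -- available.
  let i := H₁.isoIsPullback _ _ H
  have i₁ : i.hom ≫ ρ₁ = (incl P J).map prod.snd := H₁.isoIsPullback_hom_fst _ _ H
  have i₂ : i.hom ≫ ρ₂ = ((incl P J).map prod.fst ≫ reindexMap P u D) ≫ α.hom :=
    H₁.isoIsPullback_hom_snd _ _ H
  have hg' : P.IsHomLift u (i.hom ≫ g ≫ β.inv) := by
    refine isHomLift_of_comp_vert (ψ := (incl P I).map (hT.from Z)) inferInstance ?_
    have : (i.hom ≫ g ≫ β.inv) ≫ (incl P I).map (hT.from Z) =
        (incl P J).map prod.snd ≫ s := by simp [← hζ, hg, reassoc_of% i₁]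
    rw [this]
    infer_instance
  obtain ⟨h, ⟨hh, hh'⟩, huniq⟩ :=
    existsUnique_exponential_transpose u hT ev hev A (i.hom ≫ g ≫ β.inv) hg'
  have hs' (f : (incl P J).obj A ⟶ (incl P I).obj T) (hf : P.IsHomLift u f) : f = s :=
    hs f (by rw [IsHomLift.fac' P u f, IsHomLift.fac' P u s])
  refine ⟨h, ⟨hs' _ inferInstance, fun l hl₁ hl₂ => ?_⟩, ?_⟩
  · have := hh' (i.hom ≫ l) ?_ ?_
    · rw [Category.assoc, cancel_epi] at this
      rw [← Category.assoc, this]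
      simp
    · rw [← cancel_mono α.hom, ← i₂, ← hl₂]
      simp
    · rw [Category.assoc, hl₁, reassoc_of% i₁]
  · rintro k ⟨hk, hk'⟩
    refine huniq k ⟨isHomLift_of_comp_vert (ψ := (incl P I).map (hT.from E)) inferInstance
      (hk ▸ hu), fun l hl₁ hl₂ => ?_⟩
    have := hk' (i.inv ≫ l) ?_ ?_
    · rw [← this]
      simp
    · rw [Category.assoc, hl₂, ← i₁]
      simp
    · rw [Category.assoc, reassoc_of% hl₁, Iso.inv_comp_eq, i₂]
      simp

lemma hasExponentialOver_incl [IsFibredTopos P] {I : B} {T D Z : P.Fiber I}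
    (hT' : IsOne P ((incl P I).obj T)) {d z : X}
    (α : (incl P I).obj D ≅ d) (β : (incl P I).obj Z ≅ z)
    (δ : d ⟶ (incl P I).obj T) (ζ : z ⟶ (incl P I).obj T)
    (hδ : P.IsHomLift (𝟙 I) (α.hom ≫ δ)) (hζ : P.IsHomLift (𝟙 I) (β.hom ≫ ζ)) :
    HasExponentialOver P δ ζ := by
  have hT := hT'.isTerminal
  have hδ' : α.hom ≫ δ = (incl P I).map (hT.from D) :=
    hT'.hom_ext (by rw [IsHomLift.fac' P (𝟙 I) (α.hom ≫ δ), map_incl_map]; simp)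
  have hζ' : β.hom ≫ ζ = (incl P I).map (hT.from Z) :=
    hT'.hom_ext (by rw [IsHomLift.fac' P (𝟙 I) (β.hom ≫ ζ), map_incl_map]; simp)
  obtain ⟨E, ev, hev⟩ := IsTopos.exists_exponential D Z
  refine ⟨(incl P I).obj E, (incl P I).obj (D ⨯ E), (incl P I).map (hT.from E),
    (incl P I).map prod.snd, (incl P I).map prod.fst ≫ α.hom, (incl P I).map ev ≫ β.hom,
    inferInstance, ?_, ?_, ?_⟩
  · exact IsPullback.of_iso (isPullback_incl_prod hT (hT.from E) (hT.from D)) (Iso.refl _)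
      (Iso.refl _) α (Iso.refl _) (by simp) (by simp) (by simp) (by simp [hδ'])
  · rw [Category.assoc, hζ', ← Functor.map_comp, ← Functor.map_comp]
    exact congrArg _ (hT.hom_ext _ _)
  · intro x xd s ρ₁ ρ₂ H g hg
    exact existsUnique_exponential_incl (A := fiberObj P x) hT ev hev α β hδ' hζ' s ρ₁ ρ₂ H g hg
      fun f hf => hT'.hom_ext hf

lemma hasExponentialOver [IsFibredTopos P] {T d z : X} (hT : IsOne P T) (δ : d ⟶ T) (ζ : z ⟶ T)
    [IsIso (P.map δ)] [IsIso (P.map ζ)] : HasExponentialOver P δ ζ := by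
  obtain ⟨D, α, hα⟩ := exists_fiber_iso (P := P) δ
  obtain ⟨Z, β, hβ⟩ := exists_fiber_iso (P := P) ζ
  exact hasExponentialOver_incl (T := fiberObj P T) hT α β δ ζ hα hβ

end Exponentials

/-! ### Subobject classifiers universal for the total category -/

section Classifiers

variable {B : Type u₁} [Category.{v₁} B] {X : Type u₂} [Category.{v₂} X] {P : X ⥤ B}

lemma isPullback_congr_iso_iff {C : Type u} [Category.{v} C] {a b a' b' : C} {t : a ⟶ b}
    {t' : a' ⟶ b'} (e₁ : a' ≅ a) (e₂ : b' ≅ b) (w : t' ≫ e₂.hom = e₁.hom ≫ t) {y x : C}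
    (m : y ⟶ x) (k : y ⟶ a) (χ : x ⟶ b) :
    IsPullback m k χ t ↔ IsPullback m (k ≫ e₁.inv) (χ ≫ e₂.inv) t' := by
  constructor
  · intro h
    exact IsPullback.of_iso h (Iso.refl _) (Iso.refl _) e₁.symm e₂.symm (by simp) (by simp)
      (by simp) (by simp [Iso.comp_inv_eq, w])
  · intro h
    exact IsPullback.of_iso h (Iso.refl _) (Iso.refl _) e₁ e₂ (by simp) (by simp) (by simp) w

/-- Logicality only makes the reindexed truth arrow isomorphic to that of some classifier; the
universal property is carried across this isomorphism. -/
lemma existsUnique_reindex_classify [IsFibredTopos P] {I J : B} (u : J ⟶ I)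
    (c : Subobject.Classifier (P.Fiber I)) {Y A : P.Fiber J} (m : Y ⟶ A) [Mono m] :
    ∃! χ : A ⟶ (reindex P u).obj c.Ω,
      ∃ k, IsPullback m k χ ((reindex P u).map c.truth) := by
  obtain ⟨c', ⟨i⟩⟩ := IsLogical.classifier (F := reindex P u) c
  obtain ⟨e₁, e₂, w⟩ : ∃ (e₁ : c'.Ω₀ ≅ (reindex P u).obj c.Ω₀)
      (e₂ : c'.Ω ≅ (reindex P u).obj c.Ω),
      c'.truth ≫ e₂.hom = e₁.hom ≫ (reindex P u).map c.truth :=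
    ⟨Arrow.leftFunc.mapIso i, Arrow.rightFunc.mapIso i, (Arrow.w i.hom).symm⟩
  refine ⟨c'.χ m ≫ e₂.hom, ⟨c'.χ₀ Y ≫ e₁.hom, ?_⟩, ?_⟩
  · rw [isPullback_congr_iso_iff e₁ e₂ w]
    simpa using c'.isPullback m
  · rintro χ ⟨k, hk⟩
    rw [isPullback_congr_iso_iff e₁ e₂ w] at hk
    rw [← c'.uniq m hk]
    simp

variable (P) in
/-- There is a subobject classifier among the objects vertical over `T`, and its universal
property holds with respect to all arrows into `T`. -/
def HasClassifierOver (T : X) : Prop :=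
  ∃ (Ω : X) (ω : Ω ⟶ T) (tr : T ⟶ Ω), IsIso (P.map ω) ∧
    ∀ {y x : X} (s : x ⟶ T) (m : y ⟶ x) [Mono m] [IsIso (P.map m)],
      ∃! χ : x ⟶ Ω, χ ≫ ω = s ∧ IsPullback m (m ≫ s) χ tr

/-- The reindexing square of `c.truth` is a pullback. Pasting with it, and cancelling it, translates
between classification in the fibre over `J` and classification by arrows over `u` into `c.Ω`. -/
lemma existsUnique_classify_incl [IsFibredTopos P] {I J : B} (c : Subobject.Classifier (P.Fiber I))
    {Y A : P.Fiber J} {y : X} (i : (incl P J).obj Y ≅ y)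
    (m : y ⟶ (incl P J).obj A) (_ : Mono m) (hm : P.IsHomLift (𝟙 J) (i.hom ≫ m))
    (s : (incl P J).obj A ⟶ (incl P I).obj c.Ω₀)
    (hs : ∀ {a : X} (f g : a ⟶ (incl P I).obj c.Ω₀), P.map f = P.map g → f = g) :
    ∃! χ : (incl P J).obj A ⟶ (incl P I).obj c.Ω, χ ≫ (incl P I).map (c.χ₀ c.Ω) = s ∧
      IsPullback m (m ≫ s) χ ((incl P I).map c.truth) := by
  obtain ⟨u, hu⟩ := exists_isHomLift_incl s
  let m' : Y ⟶ A := ⟨i.hom ≫ m, hm⟩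
  have hm' : (incl P J).map m' = i.hom ≫ m := rfl
  have : Mono ((incl P J).map m') := hm' ▸ inferInstance
  have : Mono m' := (incl P J).mono_of_mono_map this
  obtain ⟨χ, ⟨k, hk⟩, hχ⟩ := existsUnique_reindex_classify u c m'
  have hs' {Y' : P.Fiber J} {f g : (incl P J).obj Y' ⟶ (incl P I).obj c.Ω₀}
      (hf : P.IsHomLift u f) (hg : P.IsHomLift u g) : f = g :=
    hs f g (by rw [IsHomLift.fac' P u f, IsHomLift.fac' P u g])
  have hms : P.IsHomLift u (i.hom ≫ m ≫ s) := by
    have : P.IsHomLift (𝟙 J ≫ u) ((i.hom ≫ m) ≫ s) := inferInstance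
    simpa using this
  refine ⟨(incl P J).map χ ≫ reindexMap P u c.Ω, ⟨hs' inferInstance hu, ?_⟩, ?_⟩
  · refine IsPullback.of_iso ((isPullback_incl hk).paste_vert (reindexMap_isPullback u c.truth))
      i (Iso.refl _) (Iso.refl _) (Iso.refl _) (by simp [hm']) ?_ (by simp) (by simp)
    rw [Iso.refl_hom, Category.comp_id]
    exact hs' inferInstance hms
  · rintro χ' ⟨hχ', h⟩
    obtain ⟨χ₁, rfl, -⟩ := existsUnique_reindex_lift P u c.Ω A χ'
      (isHomLift_of_comp_vert (ψ := (incl P I).map (c.χ₀ c.Ω)) inferInstance (hχ' ▸ hu))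
    obtain ⟨k', hk', -⟩ := existsUnique_reindex_lift P u c.Ω₀ Y _ hms
    have h' : IsPullback ((incl P J).map m') ((incl P J).map k' ≫ reindexMap P u c.Ω₀)
        ((incl P J).map χ₁ ≫ reindexMap P u c.Ω) ((incl P I).map c.truth) :=
      IsPullback.of_iso h i.symm (Iso.refl _) (Iso.refl _) (Iso.refl _) (by simp [hm'])
        (by simp [hk']) (by simp) (by simp)
    have w : m' ≫ χ₁ = k' ≫ (reindex P u).map c.truth := by
      apply reindex_hom_ext
      rw [Functor.map_comp, Functor.map_comp, Category.assoc, Category.assoc,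
        reindexMap_naturality, h'.w, Category.assoc]
    have h'' := IsPullback.of_bot h' (by rw [← Functor.map_comp, w, Functor.map_comp])
      (reindexMap_isPullback u c.truth)
    rw [hχ χ₁ ⟨k', isPullback_of_incl h''⟩]

lemma HasClassifierOver.of_iso {T T' : X} (e : T ≅ T') (h : HasClassifierOver P T) :
    HasClassifierOver P T' := by
  obtain ⟨Ω, ω, tr, hω, H⟩ := h
  refine ⟨Ω, ω ≫ e.hom, e.inv ≫ tr, by rw [P.map_comp]; infer_instance, fun s m _ _ => ?_⟩
  obtain ⟨χ, ⟨h₁, h₂⟩, hu⟩ := H (s ≫ e.inv) m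
  refine ⟨χ, ⟨by simp [reassoc_of% h₁], ?_⟩, fun χ' hχ' => hu χ' ⟨by simp [← hχ'.1], ?_⟩⟩
  · exact IsPullback.of_iso h₂ (Iso.refl _) (Iso.refl _) e (Iso.refl _) (by simp) (by simp)
      (by simp) (by simp)
  · exact IsPullback.of_iso hχ'.2 (Iso.refl _) (Iso.refl _) e.symm (Iso.refl _) (by simp)
      (by simp) (by simp) (by simp)

lemma hasClassifierOver_incl [IsFibredTopos P] {I : B} {T : P.Fiber I}
    (hT' : IsOne P ((incl P I).obj T)) : HasClassifierOver P ((incl P I).obj T) := by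
  obtain ⟨c⟩ := HasSubobjectClassifier.exists_classifier (C := P.Fiber I)
  let e : (incl P I).obj c.Ω₀ ≅ (incl P I).obj T :=
    (incl P I).mapIso (c.isTerminalΩ₀.uniqueUpToIso hT'.isTerminal)
  refine HasClassifierOver.of_iso e ⟨(incl P I).obj c.Ω, (incl P I).map (c.χ₀ _),
    (incl P I).map c.truth, inferInstance, fun {y x} s m hm _ => ?_⟩
  obtain ⟨Y, i, hi⟩ := exists_fiber_iso (P := P) m
  refine existsUnique_classify_incl c (A := fiberObj P x) i m hm hi s fun f g hfg => ?_
  rw [← cancel_mono e.hom]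
  exact hT'.hom_ext (by simp [hfg])

lemma hasClassifierOver [IsFibredTopos P] {T : X} (hT : IsOne P T) : HasClassifierOver P T :=
  hasClassifierOver_incl (T := fiberObj P T) hT

end Classifiers

/-! ### Frobenius reciprocity and descent of vertical subobjects -/

section Stability

variable {B : Type u₁} [Category.{v₁} B] {X : Type u₂} [Category.{v₂} X] {P : X ⥤ B}

/-- To test that an arrow is cocartesian it suffices to look at arrows over a terminal object of
the fibre of its codomain. -/
lemma isCocart_iff_over [P.IsFibered] {T a b : X} (hT : IsOne P T) (t : b ⟶ T) [IsIso (P.map t)]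
    (φ : a ⟶ b) :
    IsCocart P φ ↔ ∀ {z : X} (ζ : z ⟶ T) [IsIso (P.map ζ)] (g : a ⟶ z), g ≫ ζ = φ ≫ t →
      ∃! h : b ⟶ z, h ≫ ζ = t ∧ φ ≫ h = g := by
  constructor
  · intro hφ z ζ _ g hg
    obtain ⟨h, hh, hh'⟩ := hφ.exists_desc (P.map t ≫ inv (P.map ζ)) g
      (by rw [← Category.assoc, IsIso.eq_comp_inv, ← P.map_comp, hg, P.map_comp])
    refine ⟨h, ⟨hT.hom_ext (by simp [hh]), hh'⟩, ?_⟩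
    rintro k ⟨hk, hk'⟩
    refine hφ.hom_ext ?_ (by rw [hk', hh'])
    rw [hh, IsIso.eq_comp_inv, ← P.map_comp, hk]
  · intro H
    refine (isCocart_iff φ).2 fun {z} w g hg => ?_
    -- An arbitrary target `z` is replaced by its reindexing `z'` to the base object of `T`, which
    -- is vertical over `T`.
    obtain ⟨z', e, κ, hκ, hκ'⟩ := exists_isCart P z (inv (P.map t) ≫ w)
    obtain ⟨ζ, hζ, -⟩ := hT e.hom
    have : IsIso (P.map ζ) := hζ ▸ inferInstance
    obtain ⟨g', hg', hg''⟩ := hκ'.exists_lift (P.map φ ≫ P.map t ≫ e.inv) g (by simp [hκ, hg])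
    obtain ⟨h, ⟨h₁, h₂⟩, hu⟩ := H ζ g' (hT.hom_ext (by simp [hg', hζ]))
    have hPh : P.map h = P.map t ≫ e.inv := by
      rw [Iso.eq_comp_inv, ← hζ, ← P.map_comp, h₁]
    refine ⟨h ≫ κ, ⟨by simp [hPh, hκ], by rw [reassoc_of% h₂, hg'']⟩, ?_⟩
    rintro k ⟨hk, hk'⟩
    obtain ⟨k', hk₁, rfl⟩ := hκ'.exists_lift (P.map t ≫ e.inv) k (by simp [hκ, hk])
    rw [hu k' ⟨hT.hom_ext (by simp [hk₁, hζ]), hκ'.hom_ext (by simp [hk₁, hg']) (by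
      rw [Category.assoc, hk', hg''])⟩]

instance isIso_map_comp {a b c : X} (f : a ⟶ b) (g : b ⟶ c) [IsIso (P.map f)]
    [IsIso (P.map g)] : IsIso (P.map (f ≫ g)) := by
  rw [P.map_comp]
  infer_instance

lemma isIso_map_of_comp {a b c : X} {f : a ⟶ b} {g : b ⟶ c} {h : a ⟶ c} (w : f ≫ g = h)
    [IsIso (P.map g)] [IsIso (P.map h)] : IsIso (P.map f) := by
  subst w
  have : IsIso (P.map f ≫ P.map g) := by
    rw [← P.map_comp]
    infer_instance
  exact IsIso.of_isIso_comp_right (P.map f) (P.map g)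

/-- The arrow classifying the identity of `T` is `tr` itself. -/
lemma HasClassifierOver.truth_comp {T Ω : X} {ω : Ω ⟶ T} {tr : T ⟶ Ω}
    (H : ∀ {y x : X} (s : x ⟶ T) (m : y ⟶ x) [Mono m] [IsIso (P.map m)],
      ∃! χ : x ⟶ Ω, χ ≫ ω = s ∧ IsPullback m (m ≫ s) χ tr) : tr ≫ ω = 𝟙 T := by
  obtain ⟨χ, ⟨h₁, h₂⟩, -⟩ := H (𝟙 T) (𝟙 T)
  rw [← h₁]
  simpa using h₂.w.symm =≫ ω

variable [HasPullbacks B] [IsFibredTopos P]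

lemma isIso_map_fst {p a b c : X} {π₁ : p ⟶ a} {π₂ : p ⟶ b} {f : a ⟶ c} {g : b ⟶ c}
    (h : IsPullback π₁ π₂ f g) [IsIso (P.map g)] : IsIso (P.map π₁) :=
  (map_isPullback P h).isIso_fst_of_isIso

lemma isIso_map_snd {p a b c : X} {π₁ : p ⟶ a} {π₂ : p ⟶ b} {f : a ⟶ c} {g : b ⟶ c}
    (h : IsPullback π₁ π₂ f g) [IsIso (P.map f)] : IsIso (P.map π₂) :=
  (map_isPullback P h).isIso_snd_of_isIso

/-- Frobenius reciprocity: cocartesian arrows are stable under pullback along the projections of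
products in a fibre. -/
lemma IsCocart.of_isPullback_proj {T a b d p p' : X} (hT : IsOne P T) {φ : a ⟶ b}
    (hφ : IsCocart P φ) (t : b ⟶ T) [IsIso (P.map t)] (δ : d ⟶ T) [IsIso (P.map δ)]
    {q₁ : p ⟶ b} {q₂ : p ⟶ d} (hp : IsPullback q₁ q₂ t δ) {φ' : p' ⟶ p} {r : p' ⟶ a}
    (hp' : IsPullback φ' r q₁ φ) : IsCocart P φ' := by
  have := isIso_map_fst (P := P) hp
  rw [isCocart_iff_over hT (q₁ ≫ t)]
  intro z ζ _ g hg
  -- Here `e` is the exponential `z ^ d` over `T`. Arrows `p ⟶ z` transpose to `b ⟶ e` and arrows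
  -- `p' ⟶ z` to `a ⟶ e`, so the claim becomes the universal property of `φ` against `e`.
  obtain ⟨e, ed, ε, π₁, π₂, ev, hε, hed, hev, H⟩ := hasExponentialOver hT δ ζ
  have hp'' := hp'.flip.paste_vert hp
  obtain ⟨h, ⟨hh, hl⟩, hu⟩ := H (φ ≫ t) r (φ' ≫ q₂) hp''
    g (by rw [hg, reassoc_of% hp'.w])
  have hφ₀ := (isCocart_iff_over hT t φ).1 hφ ε h hh
  obtain ⟨h', ⟨h₁, h₂⟩, hu'⟩ := hφ₀
  have hl₀ (k : b ⟶ e) (hk : k ≫ ε = t) : (q₁ ≫ k) ≫ ε = q₂ ≫ δ := by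
    rw [Category.assoc, hk, hp.w]
  refine ⟨hed.lift (q₁ ≫ h') q₂ (hl₀ h' h₁) ≫ ev, ⟨?_, ?_⟩, ?_⟩
  · rw [Category.assoc, hev, hed.lift_fst_assoc, Category.assoc, h₁]
  · rw [← Category.assoc]
    refine hl _ ?_ ?_
    · rw [Category.assoc, hed.lift_fst, reassoc_of% hp'.w, h₂]
    · rw [Category.assoc, hed.lift_snd]
  · rintro G ⟨hG, hG'⟩
    obtain ⟨k, ⟨hk, hkl⟩, -⟩ := H t q₁ q₂ hp G hG
    have hkG := hkl (hed.lift (q₁ ≫ k) q₂ (hl₀ k hk)) (hed.lift_fst _ _ _) (hed.lift_snd _ _ _)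
    have : φ ≫ k = h := by
      refine hu _ ⟨by rw [Category.assoc, hk], fun l hl₁ hl₂ => ?_⟩
      have : l = φ' ≫ hed.lift (q₁ ≫ k) q₂ (hl₀ k hk) := by
        refine hed.hom_ext ?_ ?_
        · rw [hl₁, Category.assoc, hed.lift_fst, reassoc_of% hp'.w]
        · rw [hl₂, Category.assoc, hed.lift_snd]
      rw [this, Category.assoc, hkG, hG']
    obtain rfl := hu' k ⟨hk, this⟩
    rw [hkG]

/-- Vertical subobjects of the domain of a cocartesian arrow descend to its codomain. -/
lemma IsCocart.exists_mono_isPullback {a b s : X} {φ : a ⟶ b} (hφ : IsCocart P φ) (m' : s ⟶ a)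
    [Mono m'] [IsIso (P.map m')] :
    ∃ (S : X) (m : S ⟶ b) (ζ : s ⟶ S), Mono m ∧ IsIso (P.map m) ∧ IsPullback ζ m' m φ := by
  have := hasPullbacks_total P
  obtain ⟨T, t, hT, ht⟩ := exists_isOne P b
  obtain ⟨Ω, ω, tr, hω, H⟩ := hasClassifierOver hT
  have htr := HasClassifierOver.truth_comp H
  have : Mono tr := mono_of_mono_fac htr
  have : IsIso (P.map tr) := isIso_map_of_comp htr
  -- The characteristic arrow of `m'` has a vertical target over `T`, so it extends along `φ`; the
  -- extension classifies the required subobject of `b`.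
  obtain ⟨χ, ⟨h₁, h₂⟩, -⟩ := H (φ ≫ t) m'
  obtain ⟨χ', ⟨h₃, rfl⟩, -⟩ := (isCocart_iff_over hT t φ).1 hφ ω χ h₁
  have h := IsPullback.of_hasPullback χ' tr
  exact ⟨_, pullback.fst χ' tr, _, inferInstance, isIso_map_fst h,
    IsPullback.of_right' h₂.flip h.flip⟩

/-- Vertical subobjects of the codomain of a cocartesian arrow are determined by their pullback
to its domain. -/
lemma IsCocart.exists_mono_fac {a b s S₁ S₂ : X} {φ : a ⟶ b} (hφ : IsCocart P φ) {m₁ : S₁ ⟶ b}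
    {m₂ : S₂ ⟶ b} [Mono m₁] [Mono m₂] [IsIso (P.map m₁)] [IsIso (P.map m₂)] {m' : s ⟶ a}
    {ζ₁ : s ⟶ S₁} {ζ₂ : s ⟶ S₂} (h₁ : IsPullback ζ₁ m' m₁ φ) (h₂ : IsPullback ζ₂ m' m₂ φ) :
    ∃ θ : S₁ ⟶ S₂, θ ≫ m₂ = m₁ := by
  obtain ⟨T, t, hT, ht⟩ := exists_isOne P b
  obtain ⟨Ω, ω, tr, hω, H⟩ := hasClassifierOver hT
  have : Mono m' := h₁.mono_snd_of_mono
  have := isIso_map_snd (P := P) h₁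
  obtain ⟨χ₁, ⟨k₁, l₁⟩, -⟩ := H t m₁
  obtain ⟨χ₂, ⟨k₂, l₂⟩, -⟩ := H t m₂
  have e₁ := h₁.flip.paste_vert l₁
  have e₂ := h₂.flip.paste_vert l₂
  rw [reassoc_of% h₁.w] at e₁
  rw [reassoc_of% h₂.w] at e₂
  -- Both composites classify `m'`; arrows `b ⟶ Ω` over `T` that agree after `φ` are equal.
  have e : φ ≫ χ₁ = φ ≫ χ₂ := (H (φ ≫ t) m').unique ⟨by simp [k₁], e₁⟩ ⟨by simp [k₂], e₂⟩
  have : χ₁ = χ₂ := ((isCocart_iff_over hT t φ).1 hφ ω (φ ≫ χ₂) (by simp [k₂])).unique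
    ⟨k₁, e⟩ ⟨k₂, rfl⟩
  subst this
  exact ⟨l₂.lift m₁ (m₁ ≫ t) l₁.w, l₂.lift_fst _ _ _⟩

/-- The equalizer is a pullback of the diagonal of `ζ`; that diagonal is vertical, hence so is the
equalizer. -/
lemma exists_vert_equalizer {d z T : X} (h₁ h₂ : d ⟶ z) (ζ : z ⟶ T) [IsIso (P.map ζ)]
    (h : h₁ ≫ ζ = h₂ ≫ ζ) :
    ∃ (E : X) (e : E ⟶ d), Mono e ∧ IsIso (P.map e) ∧ e ≫ h₁ = e ≫ h₂ ∧
      ∀ {w : X} (k : w ⟶ d), k ≫ h₁ = k ≫ h₂ → ∃ l, l ≫ e = k := by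
  have := hasPullbacks_total P
  have : IsIso (P.map (pullback.fst ζ ζ)) := isIso_map_fst (IsPullback.of_hasPullback ζ ζ)
  have : IsIso (P.map (pullback.diagonal ζ)) := isIso_map_of_comp (pullback.diagonal_fst ζ)
  have H := IsPullback.of_hasPullback (pullback.lift h₁ h₂ h) (pullback.diagonal ζ)
  refine ⟨_, pullback.fst (pullback.lift h₁ h₂ h) (pullback.diagonal ζ), inferInstance,
    isIso_map_fst H, ?_, fun k hk => ⟨H.lift k (k ≫ h₁) ?_, H.lift_fst _ _ _⟩⟩
  · have e₁ := H.w =≫ pullback.fst ζ ζ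
    have e₂ := H.w =≫ pullback.snd ζ ζ
    simp only [Category.assoc, pullback.lift_fst, pullback.lift_snd, pullback.diagonal_fst,
      pullback.diagonal_snd] at e₁ e₂
    rw [e₁, e₂]
  · refine pullback.hom_ext ?_ ?_ <;>
      simp only [Category.assoc, pullback.lift_fst, pullback.lift_snd, pullback.diagonal_fst,
        pullback.diagonal_snd, hk, Category.comp_id]

/-- A pullback of a cocartesian arrow along a vertical mono is epic with respect to vertical
targets. -/
lemma IsCocart.eq_of_isPullback_mono {a b d a' z T : X} {φ : a ⟶ b} (hφ : IsCocart P φ)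
    {m : d ⟶ b} [Mono m] [IsIso (P.map m)] {φ' : a' ⟶ d} {m' : a' ⟶ a}
    (H : IsPullback φ' m' m φ) (ζ : z ⟶ T) [IsIso (P.map ζ)] {h₁ h₂ : d ⟶ z}
    (hζ : h₁ ≫ ζ = h₂ ≫ ζ) (h : φ' ≫ h₁ = φ' ≫ h₂) : h₁ = h₂ := by
  -- As `φ'` factors through the equalizer `E`, the subobjects `E` and `d` of `b` have the same
  -- pullback along `φ`, so `d` is contained in `E`.
  obtain ⟨E, e, _, _, he, hu⟩ := exists_vert_equalizer (P := P) h₁ h₂ ζ hζ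
  obtain ⟨l, hl⟩ := hu φ' h
  have H' : IsPullback l m' (e ≫ m) φ := by
    refine isPullback_of_existsUnique (by rw [reassoc_of% hl, H.w]) fun x y hxy => ?_
    refine ⟨H.lift (x ≫ e) y (by simpa using hxy), ⟨?_, H.lift_snd _ _ _⟩, ?_⟩
    · rw [← cancel_mono e, Category.assoc, hl, H.lift_fst]
    · rintro k ⟨hk, hk'⟩
      exact H.hom_ext (by rw [H.lift_fst, ← hk, Category.assoc, hl]) (by rw [H.lift_snd, hk'])
  obtain ⟨θ, hθ⟩ := hφ.exists_mono_fac H H'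
  have hθ' : θ ≫ e = 𝟙 d := by
    rw [← cancel_mono m, Category.assoc, hθ, Category.id_comp]
  rw [← Category.id_comp h₁, ← Category.id_comp h₂, ← hθ', Category.assoc, he, Category.assoc]

end Stability

/-! ### Universality and disjointness of internal sums -/

section Universality

variable {B : Type u₁} [Category.{v₁} B] {X : Type u₂} [Category.{v₂} X] {P : X ⥤ B}

lemma mono_of_isPullback_eq {k a b : X} {f : a ⟶ b} {k₁ k₂ : k ⟶ a} (h : IsPullback k₁ k₂ f f)
    (e : k₁ = k₂) : Mono f :=
  ⟨fun x y w => (h.lift_fst x y w).symm.trans (e ▸ h.lift_snd x y w)⟩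

/-- A cocartesian arrow over a mono is cartesian. -/
lemma IsCocart.isCart_of_mono [P.IsFibered] [HasInternalSums P] {a s : X} {c : a ⟶ s}
    (hc : IsCocart P c) [Mono (P.map c)] :
    IsCart P c := by
  obtain ⟨e, f, κ, _, hκ, rfl⟩ := exists_vert_cart_factorization P c
  -- Because `P.map κ` is monic, the square with an identity side lies over a pullback, so
  -- Beck–Chevalley applies to it. The vertical part `f` is then cocartesian, hence invertible.
  have hf : IsCocart P f := by
    refine HasInternalSums.beckChevalley f (𝟙 a) κ (f ≫ κ) (by simp) ?_ hκ
      (isCart_of_isIso _) hc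
    have : Mono (P.map κ) := by
      have : P.map κ = inv (P.map f) ≫ P.map (f ≫ κ) := by simp
      rw [this]
      infer_instance
    rw [P.map_id, P.map_comp]
    exact IsPullback.of_vert_isIso_mono ⟨by simp⟩
  have : IsIso f := hf.isIso
  exact (isCart_of_isIso f).comp hκ

variable [HasPullbacks B] [IsFibredTopos P]

/-- If the restriction along a cocartesian arrow `φ` of a relation `R` between `b` and `z` is
single-valued, then so is `R`. -/
lemma IsCocart.mono_of_graph {T a b z bz az R s : X} (hT : IsOne P T) {φ : a ⟶ b}
    (hφ : IsCocart P φ) (t : b ⟶ T) [IsIso (P.map t)] (ζ : z ⟶ T) [IsIso (P.map ζ)]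
    {q₁ : bz ⟶ b} {q₂ : bz ⟶ z} (hq : IsPullback q₁ q₂ t ζ) {φz : az ⟶ bz} {r : az ⟶ a}
    (hz : IsPullback φz r q₁ φ) {ρ : R ⟶ bz} [Mono ρ] [IsIso (P.map ρ)] {ξ : s ⟶ R}
    {γ : s ⟶ az} (hR : IsPullback ξ γ ρ φz) (hγ : Mono (γ ≫ r)) : Mono (ρ ≫ q₁) := by
  have := hasPullbacks_total P
  have hφz : IsCocart P φz := hφ.of_isPullback_proj hT t ζ hq hz
  have : IsIso (P.map q₁) := isIso_map_fst hq
  -- This kernel pair consists of the pairs in `R` with the same first coordinate. It embeds by `κ`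
  -- as a vertical subobject of `bz ×_b bz`, which is also `bz × z` over `T`, so Frobenius applies a
  -- second time and gives `φN`.
  have hK := IsPullback.of_hasPullback (ρ ≫ q₁) (ρ ≫ q₁)
  set k₁ := pullback.fst (ρ ≫ q₁) (ρ ≫ q₁)
  set k₂ := pullback.snd (ρ ≫ q₁) (ρ ≫ q₁)
  have : IsIso (P.map k₁) := isIso_map_fst hK
  have hN := IsPullback.of_hasPullback q₁ q₁
  set n₁ := pullback.fst q₁ q₁
  set n₂ := pullback.snd q₁ q₁
  have : IsIso (P.map n₁) := isIso_map_fst hN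
  have hNT : IsPullback n₁ (n₂ ≫ q₂) (q₁ ≫ t) ζ := hN.paste_vert hq
  have haN := (IsPullback.of_hasPullback φz n₁).flip
  set φN := pullback.snd φz n₁
  set rN := pullback.fst φz n₁
  have hφN : IsCocart P φN := hφz.of_isPullback_proj hT (q₁ ≫ t) ζ hNT haN
  have hκw : (k₁ ≫ ρ) ≫ q₁ = (k₂ ≫ ρ) ≫ q₁ := by simpa using hK.w
  let κ := hN.lift (k₁ ≫ ρ) (k₂ ≫ ρ) hκw
  have hκ₁ : κ ≫ n₁ = k₁ ≫ ρ := hN.lift_fst _ _ _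
  have hκ₂ : κ ≫ n₂ = k₂ ≫ ρ := hN.lift_snd _ _ _
  have : Mono κ := ⟨fun x y w => hK.hom_ext
    (by rw [← cancel_mono ρ, Category.assoc, Category.assoc, ← hκ₁, reassoc_of% w])
    (by rw [← cancel_mono ρ, Category.assoc, Category.assoc, ← hκ₂, reassoc_of% w])⟩
  have : IsIso (P.map κ) := isIso_map_of_comp hκ₁
  have hK' := IsPullback.of_hasPullback κ φN
  set κ' := pullback.fst κ φN
  set κa := pullback.snd κ φN
  let x₁ := hR.lift (κ' ≫ k₁) (κa ≫ rN)
    (by rw [Category.assoc, ← hκ₁, reassoc_of% hK'.w, haN.w, Category.assoc])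
  let y := hz.lift (κ' ≫ k₂ ≫ ρ) (κa ≫ rN ≫ r) (by
    rw [Category.assoc, ← hκw, ← hκ₁, Category.assoc, reassoc_of% hK'.w, reassoc_of% haN.w,
      hz.w, Category.assoc, Category.assoc])
  let x₂ := hR.lift (κ' ≫ k₂) y (by rw [hz.lift_fst, Category.assoc])
  -- After restriction along `φN`, the two members of a pair come from points of `s` with the same
  -- image in `a`.
  have hx : x₁ = x₂ := by
    rw [← cancel_mono (γ ≫ r)]
    simp [x₁, x₂, y]
  have e : κ' ≫ k₁ = κ' ≫ k₂ := by
    have h₁ : x₁ ≫ ξ = κ' ≫ k₁ := hR.lift_fst _ _ _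
    have h₂ : x₂ ≫ ξ = κ' ≫ k₂ := hR.lift_fst _ _ _
    rw [← h₁, ← h₂, hx]
  have e' : k₁ ≫ ρ ≫ q₂ = k₂ ≫ ρ ≫ q₂ := by
    -- The restriction is removed: `κ'` is a pullback of `φN` along a vertical mono, hence epic for
    -- vertical targets.
    refine hφN.eq_of_isPullback_mono hK' ζ ?_ (by rw [reassoc_of% e])
    simp only [Category.assoc, ← hq.w]
    simpa using hκw =≫ t
  refine mono_of_isPullback_eq hK ?_
  rw [← cancel_mono ρ]
  exact hq.hom_ext hκw (by simpa using e')

/-- Cocartesian arrows are stable under pullback along vertical monos. -/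
lemma IsCocart.of_isPullback_mono {a b d a' : X} {φ : a ⟶ b} (hφ : IsCocart P φ)
    {m : d ⟶ b} [Mono m] [IsIso (P.map m)] {φ' : a' ⟶ d} {m' : a' ⟶ a}
    (H : IsPullback φ' m' m φ) : IsCocart P φ' := by
  have := hasPullbacks_total P
  obtain ⟨T, t, hT, ht⟩ := exists_isOne P b
  rw [isCocart_iff_over hT (m ≫ t)]
  intro z ζ _ g hg
  refine existsUnique_of_exists_of_unique ?_ ?_
  · have hq := IsPullback.of_hasPullback t ζ
    set q₁ := pullback.fst t ζ
    set q₂ := pullback.snd t ζ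
    have : IsIso (P.map q₁) := isIso_map_fst hq
    have hz := (IsPullback.of_hasPullback φ q₁).flip
    set φz := pullback.snd φ q₁
    set r := pullback.fst φ q₁
    have hφz : IsCocart P φz := hφ.of_isPullback_proj hT t ζ hq hz
    let v := hq.lift (φ' ≫ m) g (by rw [hg, Category.assoc])
    have hv₁ : v ≫ q₁ = φ' ≫ m := hq.lift_fst _ _ _
    have hv₂ : v ≫ q₂ = g := hq.lift_snd _ _ _
    let γ := hz.lift v m' (by rw [hv₁, H.w])
    have hγ₁ : γ ≫ φz = v := hz.lift_fst _ _ _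
    have hγ₂ : γ ≫ r = m' := hz.lift_snd _ _ _
    have : Mono m' := H.mono_snd_of_mono
    have : IsIso (P.map m') := isIso_map_snd H
    have : IsIso (P.map r) := isIso_map_snd hz
    have : Mono γ := mono_of_mono_fac hγ₂
    have : IsIso (P.map γ) := isIso_map_of_comp hγ₂
    obtain ⟨R, ρ, ξ, _, _, hR⟩ := hφz.exists_mono_isPullback γ
    have : Mono (ρ ≫ q₁) := hφ.mono_of_graph hT t ζ hq hz hR (by rwa [hγ₂])
    have hR' := hR.paste_vert hz
    rw [hγ₂] at hR'
    obtain ⟨θ, hθ⟩ := hφ.exists_mono_fac H hR'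
    have e : φ' ≫ θ = ξ := by
      rw [← cancel_mono (ρ ≫ q₁), Category.assoc, hθ, H.w, hR'.w]
    refine ⟨θ ≫ ρ ≫ q₂, ?_, ?_⟩
    · rw [Category.assoc, Category.assoc, ← hq.w, ← hθ, Category.assoc, Category.assoc]
    · rw [reassoc_of% e, reassoc_of% hR.w, reassoc_of% hγ₁, hv₂]
  · rintro h₁ h₂ ⟨e₁, e₁'⟩ ⟨e₂, e₂'⟩
    exact hφ.eq_of_isPullback_mono H ζ (by rw [e₁, e₂]) (by rw [e₁', e₂'])

/-- Cocartesian arrows are stable under pullback along vertical arrows. -/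
lemma IsCocart.of_isPullback_vert {a b d a' : X} {φ : a ⟶ b} (hφ : IsCocart P φ)
    {f : d ⟶ b} [IsIso (P.map f)] {φ' : a' ⟶ d} {f' : a' ⟶ a}
    (H : IsPullback φ' f' f φ) : IsCocart P φ' := by
  have := hasPullbacks_total P
  obtain ⟨T, t, hT, ht⟩ := exists_isOne P b
  -- The arrow `f` is its graph `γ`, a vertical mono into the fibre product of `b` and `d`, followed
  -- by the projection `q₁`.
  have hq := IsPullback.of_hasPullback t (f ≫ t)
  set q₁ := pullback.fst t (f ≫ t)
  set q₂ := pullback.snd t (f ≫ t)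
  have : IsIso (P.map q₁) := isIso_map_fst hq
  have hz := (IsPullback.of_hasPullback φ q₁).flip
  set φz := pullback.snd φ q₁
  set r := pullback.fst φ q₁
  have hφz : IsCocart P φz := hφ.of_isPullback_proj hT t (f ≫ t) hq hz
  let γ := hq.lift f (𝟙 d) (by simp)
  have hγ₁ : γ ≫ q₁ = f := hq.lift_fst _ _ _
  have hγ₂ : γ ≫ q₂ = 𝟙 d := hq.lift_snd _ _ _
  have : Mono γ := mono_of_mono_fac hγ₂
  have : IsIso (P.map γ) := isIso_map_of_comp hγ₁
  rw [← hγ₁] at H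
  exact hφz.of_isPullback_mono (IsPullback.of_bot' H hz)

/-- A vertical mono between the domains of cocartesian arrows with the same codomain is
invertible. -/
lemma IsCocart.isIso_of_mono {s a b : X} {φ : a ⟶ b} (hφ : IsCocart P φ) (m : s ⟶ a) [Mono m]
    [IsIso (P.map m)] (h : IsCocart P (m ≫ φ)) : IsIso m := by
  -- The mono `m` is the pullback of some vertical `M`. Both `ζ` and `ζ ≫ M = m ≫ φ` are
  -- cocartesian, so `M` is cocartesian, hence invertible.
  obtain ⟨S, M, ζ, _, _, H⟩ := hφ.exists_mono_isPullback m
  have hζ : IsCocart P ζ := hφ.of_isPullback_mono H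
  have hM : IsCocart P M := hζ.of_comp (by rwa [H.w])
  have : IsIso M := hM.isIso
  exact H.isIso_snd_of_isIso

variable [HasInternalSums P]

variable (P) in
-- Beck–Chevalley handles the cartesian part of `ψ`, since `P` preserves the pullback; the vertical
-- part is `IsCocart.of_isPullback_vert`.
theorem sumsUniversal : SumsUniversal P := by
  intro a b c d φ' ψ' ψ φ H hφ
  have := hasPullbacks_total P
  obtain ⟨e, f, κ, _, hκ, rfl⟩ := exists_vert_cart_factorization P ψ
  have hz := (IsPullback.of_hasPullback φ κ).flip
  have hz' := map_isPullback P hz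
  have hφz : IsCocart P (pullback.snd φ κ) :=
    HasInternalSums.beckChevalley _ _ κ φ hz.w hz' hκ (hκ.of_isPullback hz hz') hφ
  exact hφz.of_isPullback_vert (IsPullback.of_bot' H hz)

variable (P) in
theorem sumsDisjoint : SumsDisjoint P := by
  intro a b k φ π₁ π₂ δ hφ H h₁ h₂
  have := hasPullbacks_total P
  obtain ⟨s, c, hc⟩ := HasInternalSums.exists_cocartesian (P := P) a (P.map δ)
  obtain ⟨m, hm⟩ : ∃ m : s ⟶ k, P.IsHomLift (𝟙 (P.obj k)) m ∧ c ≫ m = δ :=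
    (Functor.IsStronglyCocartesian.universal_property (p := P) (f := P.map δ) (φ := c) (𝟙 _)
      (P.map δ) (by simp) δ).exists
  obtain ⟨hm, hcm⟩ := hm
  have : IsIso (P.map m) := isIso_map_of_isHomLift (𝟙 (P.obj k)) m
  have hc' : IsCocart P c := isCocart_of_lift (P.map δ) c
  have : Mono δ := mono_of_mono_fac h₁
  have : Mono (P.map c) := by
    have : P.map c ≫ P.map (m ≫ π₁) = 𝟙 _ := by
      rw [← P.map_comp, reassoc_of% hcm, h₁, P.map_id]
    exact mono_of_mono_fac this
  have hcart : IsCart P c := hc'.isCart_of_mono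
  have : Mono m := by
    refine ⟨fun {w} x y hxy => ?_⟩
    have hP : P.map x = P.map y := by
      rw [← cancel_mono (P.map m), ← P.map_comp, hxy, P.map_comp]
    -- The pullback of `c` along `x` is cocartesian, so `x = y` may be tested after composing with
    -- it. There `x` factors through `c`, and so does `y` because `c` is cartesian; finally `c ≫ m =
    -- δ` is monic.
    have hx := IsPullback.of_hasPullback x c
    have hcx : IsCocart P (pullback.fst x c) := sumsUniversal P _ _ _ _ hx hc'
    refine hcx.hom_ext hP ?_
    obtain ⟨y', -, hy'⟩ := hcart.exists_lift (P.map (pullback.snd x c)) (pullback.fst x c ≫ y)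
      (by rw [P.map_comp, ← hP, ← P.map_comp, hx.w, P.map_comp])
    rw [hx.w, ← hy']
    congr 1
    rw [← cancel_mono δ, ← hcm, ← Category.assoc, ← hx.w, reassoc_of% hy', Category.assoc, hxy]
  have hπ₁ : IsCocart P π₁ := sumsUniversal P _ _ _ _ H hφ
  have hmπ : IsCocart P (m ≫ π₁) := hc'.of_comp (by
    rw [reassoc_of% hcm, h₁]
    exact isCocart_of_isIso _)
  have : IsIso m := hπ₁.isIso_of_mono m hmπ
  rw [← hcm]
  exact hc'.comp (isCocart_of_isIso m)

end Universality

/-! ### Sums and pullbacks; left exactness of `Δ` -/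

section Sums

variable {B : Type u₁} [Category.{v₁} B] {X : Type u₂} [Category.{v₂} X] {P : X ⥤ B}

section Pullbacks

variable [HasPullbacks B] [IsFibredTopos P] [HasInternalSums P]

/-- Internal sums commute with pullbacks. -/
lemma IsCocart.pullback_map {a b c p a₀ b₀ c₀ p₀ : X} {f : a ⟶ c} {g : b ⟶ c} {π₁ : p ⟶ a}
    {π₂ : p ⟶ b} (H : IsPullback π₁ π₂ f g) {f₀ : a₀ ⟶ c₀} {g₀ : b₀ ⟶ c₀} {ρ₁ : p₀ ⟶ a₀}
    {ρ₂ : p₀ ⟶ b₀} (H₀ : IsPullback ρ₁ ρ₂ f₀ g₀) {α : a ⟶ a₀} {β : b ⟶ b₀} {γ : c ⟶ c₀}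
    (hα : IsCocart P α) (hβ : IsCocart P β) (hγ : IsCocart P γ) (hf : α ≫ f₀ = f ≫ γ)
    (hg : β ≫ g₀ = g ≫ γ) {h : p ⟶ p₀} (h₁ : h ≫ ρ₁ = π₁ ≫ α) (h₂ : h ≫ ρ₂ = π₂ ≫ β) :
    IsCocart P h := by
  have := hasPullbacks_total P
  -- The arrow `h` decomposes as `a ×_c b ⟶ a ×_{c₀} b ⟶ a₀ ×_{c₀} b ⟶ a₀ ×_{c₀} b₀`: pullbacks of
  -- the diagonal of `γ`, of `α` and of `β` in turn. Disjointness is used for the first,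
  -- universality for all three.
  have hM := IsPullback.of_hasPullback f₀ (β ≫ g₀)
  set m₁ := pullback.fst f₀ (β ≫ g₀)
  set m₂ := pullback.snd f₀ (β ≫ g₀)
  have hN := IsPullback.of_hasPullback (α ≫ f₀) (β ≫ g₀)
  set n₁ := pullback.fst (α ≫ f₀) (β ≫ g₀)
  set n₂ := pullback.snd (α ≫ f₀) (β ≫ g₀)
  obtain ⟨u, hu₁, hu₂, hu⟩ : ∃ u, u ≫ ρ₁ = m₁ ∧ u ≫ ρ₂ = m₂ ≫ β ∧ IsPullback m₂ u β ρ₂ :=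
    ⟨_, H₀.flip.lift_snd _ _ _, H₀.flip.lift_fst _ _ _, IsPullback.of_bot' hM.flip H₀.flip⟩
  obtain ⟨w, hw₁, hw₂, hw⟩ : ∃ w, w ≫ m₁ = n₁ ≫ α ∧ w ≫ m₂ = n₂ ∧ IsPullback n₁ w α m₁ :=
    ⟨_, hM.lift_fst _ _ _, hM.lift_snd _ _ _, IsPullback.of_bot' hN hM⟩
  have hu' : IsCocart P u := sumsUniversal P _ _ _ _ hu.flip hβ
  have hw' : IsCocart P w := sumsUniversal P _ _ _ _ hw.flip hα
  have hD := IsPullback.of_hasPullback γ γ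
  have hδ : IsCocart P (pullback.diagonal γ) :=
    sumsDisjoint P γ _ _ _ hγ hD (pullback.diagonal_fst γ) (pullback.diagonal_snd γ)
  have ew : (π₁ ≫ α ≫ f₀) = π₂ ≫ β ≫ g₀ := by rw [hf, hg, reassoc_of% H.w]
  have ek : (n₁ ≫ f) ≫ γ = (n₂ ≫ g) ≫ γ := by
    rw [Category.assoc, Category.assoc, ← hf, ← hg, hN.w]
  let j := hN.lift π₁ π₂ ew
  have hj₁ : j ≫ n₁ = π₁ := hN.lift_fst _ _ _
  have hj₂ : j ≫ n₂ = π₂ := hN.lift_snd _ _ _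
  have hj : IsPullback j (π₁ ≫ f) (hD.lift _ _ ek) (pullback.diagonal γ) := by
    refine isPullback_of_existsUnique (hD.hom_ext ?_ ?_) fun x y hxy => ?_
    · simp [reassoc_of% hj₁]
    · simp [reassoc_of% hj₂, H.w]
    · have e₁ : (x ≫ n₁) ≫ f = y := by simpa using hxy =≫ pullback.fst γ γ
      have e₂ : (x ≫ n₂) ≫ g = y := by simpa using hxy =≫ pullback.snd γ γ
      refine ⟨H.lift (x ≫ n₁) (x ≫ n₂) (by rw [e₁, e₂]), ⟨hN.hom_ext ?_ ?_, ?_⟩, ?_⟩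
      · rw [Category.assoc, hj₁, H.lift_fst]
      · rw [Category.assoc, hj₂, H.lift_snd]
      · rw [H.lift_fst_assoc, e₁]
      · rintro l ⟨rfl, -⟩
        refine H.hom_ext ?_ ?_
        · rw [H.lift_fst, Category.assoc, hj₁]
        · rw [H.lift_snd, Category.assoc, hj₂]
  have hj' : IsCocart P j := sumsUniversal P _ _ _ _ hj hδ
  have : h = j ≫ w ≫ u := by
    refine H₀.hom_ext ?_ ?_
    · rw [h₁, Category.assoc, Category.assoc, hu₁, hw₁, reassoc_of% hj₁]
    · rw [h₂, Category.assoc, Category.assoc, hu₂, reassoc_of% hw₂, reassoc_of% hj₂]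
  rw [this]
  exact hj'.comp (hw'.comp hu')

/-- Internal sums reflect isomorphisms. -/
lemma IsCocart.isIso_of_vert {s a b : X} {φ : a ⟶ b} (hφ : IsCocart P φ) (m : s ⟶ a)
    [IsIso (P.map m)] (h : IsCocart P (m ≫ φ)) : IsIso m := by
  have := hasPullbacks_total P
  -- The diagonal of `m` is a vertical mono to which the mono case applies, since sums commute with
  -- the kernel pair of `m`. So `m` is monic, and the mono case applies to `m` itself.
  have hK := IsPullback.of_hasPullback m m
  have hk : IsCocart P (pullback.fst m m ≫ m ≫ φ) :=
    IsCocart.pullback_map hK (IsPullback.of_horiz_isIso (f := 𝟙 b) (g := 𝟙 b) (fst := 𝟙 b)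
      (snd := 𝟙 b) ⟨rfl⟩) h h hφ (by simp) (by simp) (by simp) (by simp [pullback.condition_assoc])
  have : IsIso (P.map (pullback.fst m m)) := isIso_map_fst hK
  have : IsIso (P.map (pullback.diagonal m)) := isIso_map_of_comp (pullback.diagonal_fst m)
  have : IsIso (pullback.diagonal m) := hk.isIso_of_mono _ (by
    rwa [← Category.assoc, pullback.diagonal_fst, Category.id_comp])
  have : Mono m := mono_of_isPullback_eq hK (by
    rw [← cancel_epi (pullback.diagonal m), pullback.diagonal_fst, pullback.diagonal_snd])
  exact hφ.isIso_of_mono m h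

/-- A square with vertical sides between cocartesian arrows is a pullback. -/
lemma isPullback_of_isCocart {b c b₀ c₀ : X} {β : b ⟶ b₀} {γ : c ⟶ c₀} {f : b ⟶ c}
    {f₀ : b₀ ⟶ c₀} (hβ : IsCocart P β) (hγ : IsCocart P γ) [IsIso (P.map f)]
    [IsIso (P.map f₀)] (w : β ≫ f₀ = f ≫ γ) : IsPullback β f f₀ γ := by
  have := hasPullbacks_total P
  have hQ := IsPullback.of_hasPullback f₀ γ
  have hfst : IsCocart P (pullback.fst f₀ γ) := sumsUniversal P _ _ _ _ hQ hγ
  have : IsIso (P.map (pullback.snd f₀ γ)) := isIso_map_snd hQ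
  have : IsIso (P.map (pullback.lift β f w)) := isIso_map_of_comp (pullback.lift_snd β f w)
  have : IsIso (pullback.lift β f w) :=
    hfst.isIso_of_vert _ (by rwa [pullback.lift_fst])
  exact IsPullback.of_iso_pullback ⟨w⟩ (asIso (pullback.lift β f w))
    (pullback.lift_fst _ _ _) (pullback.lift_snd _ _ _)

end Pullbacks

section DeltaLimits

variable (P)

section

variable [HasTerminal B] [HasInternalSums P]

lemma sumInj_isCocart (a : X) : IsCocart P (sumInj P a) :=
  isCocart_of_lift (terminal.from (P.obj a)) _

lemma isIso_map_sumMap {a b : X} (f : a ⟶ b) : IsIso (P.map (sumMap P f)) :=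
  isIso_map_of_isHomLift (𝟙 (⊤_ B)) _

end

lemma isOne_of_iso {T T' : X} (e : T ≅ T') (hT : IsOne P T) : IsOne P T' := by
  intro a u
  obtain ⟨f, hf, -⟩ := hT (u ≫ P.map e.inv)
  refine ⟨f ≫ e.hom, by simp [hf, ← P.map_comp], fun g hg => ?_⟩
  rw [← Iso.comp_inv_eq]
  exact hT.hom_ext (by simp [hf, hg])

variable [IsFibredTopos P]

lemma oneFunctor_map_isHomLift {I J : B} (u : J ⟶ I) : P.IsHomLift u ((oneFunctor P).map u) :=
  (existsUnique_toOne P u (one P J) (one_proj P J)).choose_spec.1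

lemma exists_isHomLift_one {z : X} {I : B} (x : z ⟶ (oneFunctor P).obj I) :
    ∃ u : P.obj z ⟶ I, P.IsHomLift u x :=
  ⟨P.map x ≫ eqToHom (one_proj P I), IsHomLift.of_fac P _ _ rfl (one_proj P I) (by simp)⟩

/-- Arrows into `1_I` correspond to base arrows into `I`, so the universal property is that of the
base square. -/
lemma isPullback_oneFunctor_map {L I J K : B} {p : L ⟶ I} {q : L ⟶ J} {f : I ⟶ K} {g : J ⟶ K}
    (H : IsPullback p q f g) :
    IsPullback ((oneFunctor P).map p) ((oneFunctor P).map q) ((oneFunctor P).map f)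
      ((oneFunctor P).map g) := by
  have hl {I J : B} (u : J ⟶ I) := oneFunctor_map_isHomLift P u
  refine isPullback_of_existsUnique (by rw [← Functor.map_comp, H.w, Functor.map_comp])
    fun {z} x y hxy => ?_
  obtain ⟨u, hu⟩ := exists_isHomLift_one P x
  obtain ⟨v, hv⟩ := exists_isHomLift_one P y
  have e : u ≫ f = v ≫ g := by
    have := hl f
    have := hl g
    refine isHomLift_unique (P := P) (x ≫ (oneFunctor P).map f) inferInstance ?_
    rw [hxy]
    infer_instance
  obtain ⟨l, hlift, huniq⟩ : ∃! l : z ⟶ (oneFunctor P).obj L, P.IsHomLift (H.lift u v e) l :=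
    existsUnique_toOne P (H.lift u v e) z rfl
  have := hl p
  have := hl q
  refine ⟨l, ⟨(existsUnique_toOne P u z rfl).unique ?_ hu,
    (existsUnique_toOne P v z rfl).unique ?_ hv⟩, ?_⟩
  · have h : P.IsHomLift (H.lift u v e ≫ p) (l ≫ (oneFunctor P).map p) := inferInstance
    rwa [H.lift_fst] at h
  · have h : P.IsHomLift (H.lift u v e ≫ q) (l ≫ (oneFunctor P).map q) := inferInstance
    rwa [H.lift_snd] at h
  · rintro l' ⟨h₁, h₂⟩
    obtain ⟨w, hw⟩ := exists_isHomLift_one P l'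
    refine huniq l' ?_
    have : w = H.lift u v e := by
      refine H.hom_ext ?_ ?_
      · rw [H.lift_fst]
        exact isHomLift_unique x (h₁ ▸ inferInstance) hu
      · rw [H.lift_snd]
        exact isHomLift_unique y (h₂ ▸ inferInstance) hv
    exact this ▸ hw

variable [HasFiniteLimits B] [HasInternalSums P]

/-- The comparison with the actual pullback is vertical, and cocartesian by `IsCocart.pullback_map`,
hence invertible. -/
lemma isPullback_sumMap {p a b c : X} {π₁ : p ⟶ a} {π₂ : p ⟶ b} {f : a ⟶ c} {g : b ⟶ c}
    (H : IsPullback π₁ π₂ f g) :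
    IsPullback (sumMap P π₁) (sumMap P π₂) (sumMap P f) (sumMap P g) := by
  have := hasPullbacks_total P
  have w : sumMap P π₁ ≫ sumMap P f = sumMap P π₂ ≫ sumMap P g := by
    have : (sumFunctor P).map π₁ ≫ (sumFunctor P).map f =
        (sumFunctor P).map π₂ ≫ (sumFunctor P).map g := by
      rw [← Functor.map_comp, H.w, Functor.map_comp]
    exact congrArg Subtype.val this
  have hQ := IsPullback.of_hasPullback (sumMap P f) (sumMap P g)
  have := isIso_map_sumMap P g
  have := isIso_map_sumMap P π₁
  have : IsIso (P.map (pullback.fst (sumMap P f) (sumMap P g))) := isIso_map_fst hQ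
  have : IsIso (P.map (pullback.lift _ _ w)) := isIso_map_of_comp (pullback.lift_fst _ _ w)
  have hc : IsCocart P (sumInj P p ≫ pullback.lift _ _ w) :=
    IsCocart.pullback_map H hQ (sumInj_isCocart P a) (sumInj_isCocart P b) (sumInj_isCocart P c)
      (sumInj_sumMap P f) (sumInj_sumMap P g)
      (by rw [Category.assoc, pullback.lift_fst, sumInj_sumMap])
      (by rw [Category.assoc, pullback.lift_snd, sumInj_sumMap])
  have : IsIso (pullback.lift _ _ w) := ((sumInj_isCocart P p).of_comp hc).isIso
  exact IsPullback.of_iso_pullback ⟨w⟩ (asIso (pullback.lift _ _ w))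
    (pullback.lift_fst _ _ _) (pullback.lift_snd _ _ _)

lemma isPullback_Delta_map {L I J K : B} {p : L ⟶ I} {q : L ⟶ J} {f : I ⟶ K} {g : J ⟶ K}
    (H : IsPullback p q f g) :
    IsPullback ((Delta P).map p) ((Delta P).map q) ((Delta P).map f) ((Delta P).map g) :=
  isPullback_of_incl (isPullback_sumMap P (isPullback_oneFunctor_map P H))

/-- The cocartesian arrow `1_1 ⟶ Δ 1` lies over an isomorphism, so it is invertible. -/
lemma isOne_Delta_terminal : IsOne P ((incl P _).obj ((Delta P).obj (⊤_ B))) := by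
  have h : IsIso (P.map (sumInj P (one P (⊤_ B)))) := by
    have : IsIso (terminal.from (P.obj (one P (⊤_ B)))) := by
      have : terminal.from (P.obj (one P (⊤_ B))) = eqToHom (one_proj P (⊤_ B)) :=
        Subsingleton.elim _ _
      rw [this]
      infer_instance
    exact isIso_map_of_isHomLift (terminal.from (P.obj (one P (⊤_ B)))) _
  have hi : IsIso (sumInj P (one P (⊤_ B))) := (sumInj_isCocart P (one P (⊤_ B))).isIso
  exact isOne_of_iso P (@asIso _ _ _ _ (sumInj P (one P (⊤_ B))) hi) (isOne_one P _)

theorem preservesFiniteLimits_Delta : PreservesFiniteLimits (Delta P) := by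
  have : PreservesLimit (Functor.empty.{0} B) (Delta P) :=
    preservesTerminal_of_iso _ ((isOne_Delta_terminal P).isTerminal.uniqueUpToIso
      terminalIsTerminal)
  have : PreservesLimitsOfShape (Discrete.{0} PEmpty) (Delta P) :=
    preservesLimitsOfShape_pempty_of_preservesTerminal _
  have (I J K : B) (f : I ⟶ K) (g : J ⟶ K) : PreservesLimit (cospan f g) (Delta P) :=
    preservesLimit_of_preserves_limit_cone (pullbackIsPullback f g)
      ((isLimitMapConePullbackConeEquiv _ _).symm
        (isPullback_Delta_map P (IsPullback.of_hasPullback f g)).isLimit)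
  have : PreservesLimitsOfShape WalkingCospan (Delta P) :=
    ⟨fun {F} => preservesLimit_of_iso_diagram _ (diagramIsoCospan F).symm⟩
  exact preservesFiniteLimits_of_preservesTerminal_and_pullbacks _

end DeltaLimits

end Sums

/-! ### Equivalences over the base -/

section BasedEquivalence

variable {B : Type u₁} [Category.{v₁} B] {X : Type u₂} [Category.{v₂} X]
  {Y : Type u₃} [Category.{v₃} Y] {Q : Y ⥤ B} {G : X ⥤ Y}

lemma isHomLift_comp_iff {I J : B} {a b : X} (u : I ⟶ J) (φ : a ⟶ b) :
    (G ⋙ Q).IsHomLift u φ ↔ Q.IsHomLift u (G.map φ) := by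
  constructor
  · rintro ⟨⟩
    exact IsHomLift.map Q (G.map φ)
  · rintro h
    obtain rfl : Q.obj (G.obj a) = I := IsHomLift.domain_eq Q u (G.map φ)
    obtain rfl : Q.obj (G.obj b) = J := IsHomLift.codomain_eq Q u (G.map φ)
    obtain rfl := (isHomLift_iff_map_eq u (G.map φ)).1 h
    exact IsHomLift.map (G ⋙ Q) φ

lemma isCart_comp_of_isCart_map [G.Full] [G.Faithful] {a b : X} {φ : a ⟶ b}
    (h : IsCart Q (G.map φ)) : IsCart (G ⋙ Q) φ := by
  refine (isCart_iff φ).2 fun {z} w g hg => ?_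
  obtain ⟨k, ⟨hk, hk'⟩, hu⟩ := (isCart_iff (G.map φ)).1 h (z := G.obj z) w (G.map g) hg
  obtain ⟨k, rfl⟩ := G.map_surjective k
  exact ⟨k, ⟨hk, G.map_injective (by simpa using hk')⟩, fun l hl =>
    G.map_injective (hu _ ⟨hl.1, by rw [← G.map_comp, hl.2]⟩)⟩

lemma isCart_map_of_isCart_comp [G.Full] [G.Faithful] [G.EssSurj] {a b : X} {φ : a ⟶ b}
    (h : IsCart (G ⋙ Q) φ) : IsCart Q (G.map φ) := by
  refine (isCart_iff (G.map φ)).2 fun {y} w g hg => ?_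
  obtain ⟨z, ⟨e⟩⟩ : ∃ z, Nonempty (G.obj z ≅ y) := ⟨_, ⟨G.objObjPreimageIso y⟩⟩
  obtain ⟨g', hg'⟩ := G.map_surjective (e.hom ≫ g)
  obtain ⟨k, ⟨hk, hk'⟩, hu⟩ := (isCart_iff φ).1 h (z := z) (Q.map e.hom ≫ w) g' (by
    simp only [Functor.comp_map, hg', Q.map_comp, hg, Category.assoc])
  refine ⟨e.inv ≫ G.map k, ⟨?_, ?_⟩, ?_⟩
  · have : Q.map (G.map k) = Q.map e.hom ≫ w := hk
    rw [Q.map_comp, this, ← Q.map_comp_assoc]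
    simp
  · rw [Category.assoc, ← G.map_comp, hk', hg']
    simp
  · rintro l ⟨hl, hl'⟩
    obtain ⟨l', hl''⟩ := G.map_surjective (e.hom ≫ l)
    rw [Iso.eq_inv_comp, ← hl'', hu l' ⟨by simp only [Functor.comp_map, hl'', Q.map_comp, hl],
      G.map_injective (by rw [G.map_comp, hl'', Category.assoc, hl', hg'])⟩]

/-- A fully faithful functor over `B` that is essentially surjective on fibres is part of an
equivalence of fibrations. -/
theorem nonempty_fibredEquivalence [G.Full] [G.Faithful]
    (h : ∀ y : Y, ∃ (x : X) (_ : Q.obj (G.obj x) = Q.obj y) (e : G.obj x ≅ y),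
      Q.IsHomLift (𝟙 (Q.obj y)) e.hom) :
    Nonempty (FibredEquivalence (G ⋙ Q) Q) := by
  choose F hF e he using h
  have : G.EssSurj := ⟨fun y => ⟨F y, ⟨e y⟩⟩⟩
  have he' (y : Y) : Q.IsHomLift (𝟙 (Q.obj y)) (e y).inv := by
    have := he y
    infer_instance
  let H : Y ⥤ X :=
    { obj := F
      map := fun {y y'} k => G.preimage ((e y).hom ≫ k ≫ (e y').inv)
      map_id := fun y => G.map_injective (by simp)
      map_comp := fun k l => G.map_injective (by simp) }
  have hGH {y y' : Y} (k : y ⟶ y') : G.map (H.map k) = (e y).hom ≫ k ≫ (e y').inv :=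
    G.map_preimage _
  have hlift {y y' : Y} (k : y ⟶ y') : Q.IsHomLift (Q.map k) (G.map (H.map k)) := by
    have := he y
    have := he' y'
    rw [hGH]
    infer_instance
  let η : 𝟭 X ≅ G ⋙ H := NatIso.ofComponents (fun x => G.preimageIso (e (G.obj x)).symm)
    fun f => G.map_injective (by simp [hGH])
  have hη (x : X) : (G ⋙ Q).IsHomLift (𝟙 (Q.obj (G.obj x))) (η.hom.app x) := by
    rw [isHomLift_comp_iff]
    simpa [η] using he' (G.obj x)
  let ε : H ⋙ G ≅ 𝟭 Y := NatIso.ofComponents (fun y => e y) fun k => by simp [hGH]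
  -- A based functor commutes with the projections strictly; this is why the preimages must lie over
  -- the same base object and `e` over an identity.
  have hw : H ⋙ G ⋙ Q = Q := CategoryTheory.Functor.ext hF fun y y' k => by
    have := hlift k
    exact IsHomLift.fac' Q (Q.map k) (G.map (H.map k))
  have hH {y y' : Y} (k : y ⟶ y') (hk : IsCart Q k) : IsCart Q (G.map (H.map k)) := by
    rw [hGH]
    exact (isCart_of_isIso _).comp (hk.comp (isCart_of_isIso _))
  exact ⟨{
    functor := { toFunctor := G, w := rfl }
    inverse := { toFunctor := H, w := hw }
    functor_cart := fun φ hφ => isCart_map_of_isCart_comp (G := G) hφ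
    inverse_cart := fun k hk => isCart_comp_of_isCart_map (hH k hk)
    unitIso := BasedNatIso.mkNatIso η hη
    counitIso := BasedNatIso.mkNatIso ε he }⟩

end BasedEquivalence

/-! ### Comparison with the glueing fibration -/

section Glueing

variable {B : Type u₁} [Category.{v₁} B] {X : Type u₂} [Category.{v₂} X] (P : X ⥤ B)

/-- The vertical arrow `a ⟶ 1` to the terminal object of its fibre. -/
noncomputable def toOne [IsFibredTopos P] (a : X) : a ⟶ (oneFunctor P).obj (P.obj a) :=
  (existsUnique_toOne P (𝟙 (P.obj a)) a rfl).choose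

instance [IsFibredTopos P] (a : X) : P.IsHomLift (𝟙 (P.obj a)) (toOne P a) :=
  (existsUnique_toOne P (𝟙 (P.obj a)) a rfl).choose_spec.1

instance [IsFibredTopos P] {I J : B} (u : J ⟶ I) : P.IsHomLift u ((oneFunctor P).map u) :=
  oneFunctor_map_isHomLift P u

lemma toOne_hom_ext [IsFibredTopos P] {a : X} {I : B} {u : P.obj a ⟶ I}
    {f g : a ⟶ (oneFunctor P).obj I} (hf : P.IsHomLift u f) (hg : P.IsHomLift u g) : f = g :=
  (existsUnique_toOne P u a rfl).unique hf hg

lemma isHomLift_toOne_comp [IsFibredTopos P] (a : X) {I : B} (u : P.obj a ⟶ I) :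
    P.IsHomLift u (toOne P a ≫ (oneFunctor P).map u) :=
  IsHomLift.comp_lift_id_left P u ((oneFunctor P).map u) (toOne P a)

lemma map_comp_toOne [IsFibredTopos P] {a b : X} (f : a ⟶ b) :
    f ≫ toOne P b = toOne P a ≫ (oneFunctor P).map (P.map f) :=
  toOne_hom_ext P (IsHomLift.comp_lift_id_right P (P.map f) f (toOne P b))
    (isHomLift_toOne_comp P a _)

variable [HasFiniteLimits B] [IsFibredTopos P] [HasInternalSums P]

/-- The comparison functor `a ↦ (∐ a ⟶ Δ (P a))` to the glueing fibration. -/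
noncomputable def toGl : X ⥤ Comma (𝟭 (P.Fiber (⊤_ B))) (Delta P) where
  obj a :=
    { left := (sumFunctor P).obj a
      right := P.obj a
      hom := (sumFunctor P).map (toOne P a) }
  map {a b} f :=
    { left := (sumFunctor P).map f
      right := P.map f
      w := by
        change (sumFunctor P).map f ≫ (sumFunctor P).map (toOne P b) =
          (sumFunctor P).map (toOne P a) ≫ (sumFunctor P).map ((oneFunctor P).map (P.map f))
        rw [← Functor.map_comp, ← Functor.map_comp, map_comp_toOne] }
  map_id a := by ext <;> simp
  map_comp f g := by ext <;> simp

/-- This recovers `a` from its image in the glueing; fullness and faithfulness are the two halves of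
its universal property. -/
lemma isPullback_sumInj (a : X) : IsPullback (sumInj P a) (toOne P a) (sumMap P (toOne P a))
    (sumInj P ((oneFunctor P).obj (P.obj a))) := by
  have := isIso_map_of_isHomLift (P := P) (𝟙 (P.obj a)) (toOne P a)
  have := isIso_map_sumMap P (toOne P a)
  exact isPullback_of_isCocart (sumInj_isCocart P _) (sumInj_isCocart P _) (sumInj_sumMap P _)

instance : (toGl P).Faithful where
  map_injective {a b f g} h := by
    have h₁ : sumMap P f = sumMap P g :=
      congrArg (fun k : (toGl P).obj a ⟶ (toGl P).obj b => (incl P _).map k.left) h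
    have h₂ : P.map f = P.map g := congrArg CommaMorphism.right h
    refine (isPullback_sumInj P b).hom_ext ?_ ?_
    · rw [← sumInj_sumMap, ← sumInj_sumMap, h₁]
    · rw [map_comp_toOne, map_comp_toOne, h₂]

instance : (toGl P).Full where
  map_surjective {a b} k := by
    let l : sumObj P a ⟶ sumObj P b := (CommaMorphism.left k).1
    let u : P.obj a ⟶ P.obj b := CommaMorphism.right k
    have hl : P.IsHomLift (𝟙 (⊤_ B)) l := (CommaMorphism.left k).2
    have hw : l ≫ sumMap P (toOne P b) =
        sumMap P (toOne P a) ≫ sumMap P ((oneFunctor P).map u) :=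
      congrArg Subtype.val k.w
    have w : (sumInj P a ≫ l) ≫ sumMap P (toOne P b) =
        (toOne P a ≫ (oneFunctor P).map u) ≫ sumInj P _ := by
      rw [Category.assoc, hw, reassoc_of% sumInj_sumMap P (toOne P a), sumInj_sumMap,
        Category.assoc]
    let f : a ⟶ b := (isPullback_sumInj P b).lift _ _ w
    have hf₁ : f ≫ sumInj P b = sumInj P a ≫ l := IsPullback.lift_fst _ _ _ _
    have hf₂ : f ≫ toOne P b = toOne P a ≫ (oneFunctor P).map u := IsPullback.lift_snd _ _ _ _
    have hfu : P.map f = u := by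
      refine isHomLift_unique (P := P) (f ≫ toOne P b)
        (IsHomLift.comp_lift_id_right P (P.map f) f (toOne P b)) ?_
      rw [hf₂]
      exact isHomLift_toOne_comp P a u
    have hfl : sumMap P f = l := by
      refine Functor.IsStronglyCocartesian.ext P (terminal.from (P.obj a)) (sumInj P a)
        (𝟙 (⊤_ B)) ?_
      rw [sumInj_sumMap, hf₁]
    exact ⟨f, CommaMorphism.ext ((incl P _).map_injective hfl) hfu⟩

lemma exists_pullback_sumInj {A : P.Fiber (⊤_ B)} {I : B} (α : A ⟶ (Delta P).obj I) :
    ∃ (x : X) (_ : P.obj x = I) (q : x ⟶ (incl P _).obj A) (t : x ⟶ (oneFunctor P).obj I),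
      IsPullback q t ((incl P _).map α) (sumInj P ((oneFunctor P).obj I)) ∧
        P.IsHomLift (𝟙 I) t := by
  have := hasPullbacks_total P
  have H := IsPullback.of_hasPullback ((incl P _).map α) (sumInj P ((oneFunctor P).obj I))
  have : IsIso (P.map (pullback.snd ((incl P _).map α) (sumInj P ((oneFunctor P).obj I)))) :=
    isIso_map_snd H
  obtain ⟨x, β, hβ⟩ : ∃ (A' : P.Fiber I) (β : (incl P I).obj A' ≅ _),
      P.IsHomLift (𝟙 I) (β.hom ≫ pullback.snd _ _) := by
    have h := exists_fiber_iso (P := P)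
      (pullback.snd ((incl P _).map α) (sumInj P ((oneFunctor P).obj I)))
    rwa [show P.obj ((oneFunctor P).obj I) = I from one_proj P I] at h
  exact ⟨_, obj_incl_obj x, _, _, IsPullback.of_iso H β.symm (Iso.refl _) (Iso.refl _)
    (Iso.refl _) ((Category.comp_id _).trans (Iso.inv_hom_id_assoc β _).symm)
    ((Category.comp_id _).trans (Iso.inv_hom_id_assoc β _).symm)
    ((Category.comp_id _).trans (Category.id_comp _).symm)
    ((Category.comp_id _).trans (Category.id_comp _).symm), hβ⟩

/-- The preimage of `α : A ⟶ Δ I` is its pullback along `1_I ⟶ Δ I`. The projection to `A` is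
cocartesian by universality, so `A` is the sum of that pullback. -/
lemma exists_toGl_iso (y : Comma (𝟭 (P.Fiber (⊤_ B))) (Delta P)) :
    ∃ (x : X) (_ : P.obj x = y.right) (e : (toGl P).obj x ≅ y),
      (gl (Delta P)).IsHomLift (𝟙 y.right) e.hom := by
  obtain ⟨A, I, α⟩ := y
  change A ⟶ (Delta P).obj I at α
  obtain ⟨x, rfl, q, t, H, ht⟩ := exists_pullback_sumInj P α
  obtain rfl : t = toOne P x := toOne_hom_ext P ht inferInstance
  have hq : IsCocart P q := sumsUniversal P _ _ _ _ H (sumInj_isCocart P _)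
  have hq' : P.IsHomLift (terminal.from (P.obj x)) q := by
    rw [show terminal.from (P.obj x) = P.map q ≫ eqToHom (obj_incl_obj A) from
      Subsingleton.elim _ _]
    exact IsHomLift.of_fac P _ _ rfl (obj_incl_obj A) (by simp)
  let θ : sumObj P x ⟶ (incl P _).obj A :=
    Functor.IsStronglyCocartesian.map P (terminal.from (P.obj x)) (sumInj P x)
      (g := 𝟙 (⊤_ B)) (Category.comp_id _).symm q
  have hθ : P.IsHomLift (𝟙 (⊤_ B)) θ := inferInstance
  have hfac : sumInj P x ≫ θ = q :=
    Functor.IsStronglyCocartesian.fac P (terminal.from (P.obj x)) (sumInj P x) _ q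
  have : IsIso (P.map θ) := isIso_map_of_isHomLift (𝟙 (⊤_ B)) θ
  have : IsIso θ := ((sumInj_isCocart P x).of_comp (hfac ▸ hq)).isIso
  let θ' : (sumFunctor P).obj x ⟶ A := ⟨θ, hθ⟩
  have : IsIso ((incl P _).map θ') := this
  have hi : IsIso θ' := isIso_of_reflects_iso θ' (incl P _)
  have w : θ' ≫ α = (sumFunctor P).map (toOne P x) := by
    refine (incl P _).map_injective ((sumInj_isCocart P x).hom_ext
      ((map_incl_map _).trans (map_incl_map _).symm) ?_)
    have h : q ≫ (incl P _).map α = sumInj P x ≫ sumMap P (toOne P x) :=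
      H.w.trans (sumInj_sumMap P _).symm
    rw [← hfac, Category.assoc] at h
    rw [Functor.map_comp]
    exact h
  refine ⟨x, rfl, Comma.isoMk (@asIso _ _ _ _ θ' hi) (Iso.refl _) ?_, ?_⟩
  · change θ' ≫ α = (sumFunctor P).map (toOne P x) ≫ (Delta P).map (𝟙 _)
    exact w.trans (((congrArg _ ((Delta P).map_id (P.obj x))).trans (Category.comp_id _)).symm)
  · exact (isHomLift_iff_map_eq _ _).2 rfl

end Glueing

end FibTopos

theorem mainTheorem5
    {B : Type u₁} [Category.{v₁} B] [HasFiniteLimits B]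
    {X : Type u₂} [Category.{v₂} X] (P : X ⥤ B)
    [FibTopos.IsFibredTopos P] [FibTopos.HasInternalSums P] :
    HasPullbacks X ∧
    FibTopos.SumsUniversal P ∧
    FibTopos.SumsDisjoint P ∧
    PreservesFiniteLimits (FibTopos.Delta P) ∧
    Nonempty (FibTopos.FibredEquivalence P (FibTopos.gl (FibTopos.Delta P))) := by
  exact ⟨FibTopos.hasPullbacks_total P, FibTopos.sumsUniversal P, FibTopos.sumsDisjoint P,
    FibTopos.preservesFiniteLimits_Delta P,
    -- The composite `toGl P ⋙ gl (Delta P)` is `P` definitionally.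
    FibTopos.nonempty_fibredEquivalence (G := FibTopos.toGl P)
      (Q := FibTopos.gl (FibTopos.Delta P)) (FibTopos.exists_toGl_iso P)⟩
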